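/- Let $\alpha\in[1/2,1]$, let $p\in[1,\infty]$ and let $\mathbb K=\mathbb R$ or $\mathbb C$. Put $\lambda(\alpha)=\frac{\sqrt5-1}{2}$ if $\frac{\sqrt5-1}{2}<\alpha\le 1$ and $\lambda(\alpha)=\sqrt2-1$ if $\frac12\le\alpha\le\frac{\sqrt5-1}{2}$. Let $X_{\alpha,p}$ be the space of (Lebesgue classes of) measurable functions $f:\mathbb R\to\mathbb K$ such that $f(x+1)=f(x)$ for almost every $x\in\mathbb R$, $f(-x)=f(x)$ for almost every $x\in(0,1-\alpha)$, and $f|_{(0,\alpha)}\in L^p(0,\alpha)$, with the norm $\|f\|_{\alpha,p}=\|f\|_{L^p(0,\alpha)}$. Let $\{x\}_\alpha\in[\alpha-1,\alpha)$ be the number congruent to $x$ modulo $1$ in that interval, and let $x_0=|\{x\}_\alpha|$ and $x_{n+1}=|\{1/x_n\}_\alpha|$ for $n\ge0$ (with $x_{n+1}=0$ if $x_n=0$), $\beta_{-1}(x)=1$ and $\beta_n(x)=x_0x_1\cdots x_n$. For $f\in X_{\alpha,p}$ the Brjuno series of $f$ is $B_f^{(\alpha)}(x)=\sum_{n\ge0}\beta_{n-1}(x)\,f(x_n)$.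 **Theorem.** $X_{\alpha,p}$ is a Banach space, and there is a bounded linear operator $T_{(\alpha)}:X_{\alpha,p}\to X_{\alpha,p}$ such that, for $f,g\in X_{\alpha,p}$, $T_{(\alpha)}f=g$ if and only if $g(x)=x\,f(1/x)$ for almost every $x\in(0,\alpha)$. Moreover: 1. The spectral radius of $T_{(\alpha)}$ on $X_{\alpha,p}$ is at most $\lambda(\alpha)$: every $z\in\mathbb K$ in the spectrum of $T_{(\alpha)}$ satisfies $|z|\le\lambda(\alpha)$, and the limit $\lim_{n\to\infty}\|T_{(\alpha)}^n\|^{1/n}$ exists and is at most $\lambda(\alpha)$. 2. $1-T_{(\alpha)}$ is invertible, with a bounded inverse. 3. For every $f\in X_{\alpha,p}$ the series $B_f^{(\alpha)}(x)$ converges absolutely for almost every $x\in\mathbb R$, its sum defines an element of $X_{\alpha,p}$, and $g=B_f^{(\alpha)}$ is the unique $g\in X_{\alpha,p}$ with $(1-T_{(\alpha)})g=f$. -/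

import Mathlib

open MeasureTheory Set Filter Topology
open scoped ENNReal

/-- The constant `λ(α)`: the golden ratio conjugate `(√5 - 1) / 2` for `α > (√5 - 1) / 2`, and
`√2 - 1` for `α ≤ (√5 - 1) / 2`. -/
noncomputable def brjunoLambda (α : ℝ) : ℝ :=
  open Classical in
  if (Real.sqrt 5 - 1) / 2 < α then (Real.sqrt 5 - 1) / 2 else Real.sqrt 2 - 1

/-- The modified fractional part `{x}_α = {x - α + 1}_1 + α - 1`, with values in `[α - 1, α)`. -/
noncomputable def alphaFract (α x : ℝ) : ℝ := Int.fract (x - α + 1) + α - 1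

/-- The sequence `x_n` of the `α`-continued fraction of `x`: `x_0 = |{x}_α|` and
`x_{n+1} = A_α (x_n) = |{1 / x_n}_α|`. Since `0⁻¹ = 0` and `{0}_α = 0`, the sequence stays at `0`
once it vanishes. -/
noncomputable def cfSeq (α x : ℝ) : ℕ → ℝ
  | 0 => |alphaFract α x|
  | n + 1 => |alphaFract α (cfSeq α x n)⁻¹|

/-- `cfBeta α x n` is `β_{n-1} = x_0 x_1 ⋯ x_{n-1}` (the index is shifted by one, `β_{-1} = 1`). -/
noncomputable def cfBeta (α x : ℝ) (n : ℕ) : ℝ := ∏ i ∈ Finset.range n, cfSeq α x i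

/-- The `n`-th term `β_{n-1}(x) f(x_n)` of the Brjuno series of `f`. -/
noncomputable def brjunoTerm {𝕜 : Type*} [RCLike 𝕜] (α : ℝ) (f : ℝ → 𝕜) (x : ℝ) (n : ℕ) : 𝕜 :=
  (cfBeta α x n : 𝕜) * f (cfSeq α x n)

/-- The (Lebesgue classes of) functions `f` on the real line that satisfy `f (x + 1) = f x` for
almost every `x`, `f (-x) = f x` for almost every `x ∈ (0, 1 - α)`, and `f ∈ L^p(0, α)`. -/
noncomputable def brjunoSpace (𝕜 : Type*) [RCLike 𝕜] (α : Icc (1 / 2 : ℝ) 1) (p : ℝ≥0∞) :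
    Submodule 𝕜 (ℝ →ₘ[(volume : Measure ℝ)] 𝕜) where
  carrier := {f | (∀ᵐ x : ℝ, f (x + 1) = f x) ∧
    (∀ᵐ x ∂(volume.restrict (Ioo (0 : ℝ) (1 - α))), f (-x) = f x) ∧
    MemLp f p (volume.restrict (Ioo (0 : ℝ) α))}
  zero_mem' := by
    have h0 : ∀ᵐ x : ℝ, (0 : ℝ →ₘ[(volume : Measure ℝ)] 𝕜) x = 0 := AEEqFun.coeFn_zero
    have h1 := (measurePreserving_add_right (volume : Measure ℝ) 1).quasiMeasurePreserving.ae h0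
    have h2 := (Measure.measurePreserving_neg (volume : Measure ℝ)).quasiMeasurePreserving.ae h0
    refine ⟨?_, ?_, ?_⟩
    · filter_upwards [h0, h1] with x a b
      rw [a, b]
    · filter_upwards [ae_restrict_of_ae h0, ae_restrict_of_ae h2] with x a b
      rw [a, b]
    · exact (memLp_congr_ae (ae_restrict_of_ae h0)).2 MemLp.zero
  add_mem' := by
    rintro f g ⟨hf1, hf2, hf3⟩ ⟨hg1, hg2, hg3⟩
    have h0 : ∀ᵐ x : ℝ, (f + g) x = f x + g x := AEEqFun.coeFn_add f g
    have h1 := (measurePreserving_add_right (volume : Measure ℝ) 1).quasiMeasurePreserving.ae h0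
    have h2 := (Measure.measurePreserving_neg (volume : Measure ℝ)).quasiMeasurePreserving.ae h0
    refine ⟨?_, ?_, ?_⟩
    · filter_upwards [h0, h1, hf1, hg1] with x a b c d
      rw [a, b, c, d]
    · filter_upwards [ae_restrict_of_ae h0, ae_restrict_of_ae h2, hf2, hg2] with x a b c d
      rw [a, b, c, d]
    · exact (memLp_congr_ae (ae_restrict_of_ae h0)).2 (hf3.add hg3)
  smul_mem' := by
    rintro c f ⟨hf1, hf2, hf3⟩
    have h0 : ∀ᵐ x : ℝ, (c • f) x = c • f x := AEEqFun.coeFn_smul c f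
    have h1 := (measurePreserving_add_right (volume : Measure ℝ) 1).quasiMeasurePreserving.ae h0
    have h2 := (Measure.measurePreserving_neg (volume : Measure ℝ)).quasiMeasurePreserving.ae h0
    refine ⟨?_, ?_, ?_⟩
    · filter_upwards [h0, h1, hf1] with x a b c
      rw [a, b, c]
    · filter_upwards [ae_restrict_of_ae h0, ae_restrict_of_ae h2, hf2] with x a b c
      rw [a, b, c]
    · exact (memLp_congr_ae (ae_restrict_of_ae h0)).2 (hf3.const_smul c)

/-- An element of the space that vanishes almost everywhere on `(0, α)` is zero. -/
theorem brjunoSpace_eq_zero {𝕜 : Type*} [RCLike 𝕜] {α : Icc (1 / 2 : ℝ) 1} {p : ℝ≥0∞}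
    (f : brjunoSpace 𝕜 α p)
    (h : ∀ᵐ x ∂(volume.restrict (Ioo (0 : ℝ) α)), (f : ℝ →ₘ[(volume : Measure ℝ)] 𝕜) x = 0) :
    f = 0 := by
  obtain ⟨hf1, hf2, -⟩ := f.2
  obtain ⟨hα1, hα2⟩ := α.2
  generalize hF : (f : ℝ →ₘ[(volume : Measure ℝ)] 𝕜) = F at h hf1 hf2
  rw [ae_restrict_iff' measurableSet_Ioo] at h hf2
  have hneg := (Measure.measurePreserving_neg (volume : Measure ℝ)).quasiMeasurePreserving.ae
    (hf2.and h)
  have hz : ∀ᵐ x : ℝ, x ∈ Ioo ((α : ℝ) - 1) α → F x = 0 := by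
    have hx0 : ∀ᵐ x : ℝ, x ≠ 0 := Measure.ae_ne volume 0
    filter_upwards [h, hneg, hx0] with x a b c hx
    rcases lt_or_gt_of_ne c with hlt | hgt
    · have hx' : -x ∈ Ioo (0 : ℝ) (1 - α) := ⟨by linarith, by linarith [hx.1]⟩
      have hb := b.1 hx'
      rw [neg_neg] at hb
      rw [hb]
      exact b.2 ⟨hx'.1, by linarith [hx'.2]⟩
    · exact a ⟨hgt, hx.2⟩
  have hall : ∀ᵐ x : ℝ, ∀ k : ℤ, (x + k ∈ Ioo ((α : ℝ) - 1) α → F (x + k) = 0) ∧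
      F (x + k + 1) = F (x + k) ∧ x + k ≠ α - 1 := by
    rw [ae_all_iff]
    intro k
    exact (measurePreserving_add_right (volume : Measure ℝ) k).quasiMeasurePreserving.ae
      (hz.and (hf1.and (Measure.ae_ne volume ((α : ℝ) - 1))))
  have hfz : ∀ᵐ x : ℝ, F x = 0 := by
    filter_upwards [hall] with x hx
    have hper : ∀ k : ℤ, F (x + k) = F x := by
      intro k
      induction k using Int.induction_on with
      | zero => simp
      | succ i ih =>
        have := (hx i).2.1
        push_cast at this ih ⊢
        rw [← add_assoc, this, ih]
      | pred i ih =>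
        have := (hx (-i - 1)).2.1
        push_cast at this ih ⊢
        rw [← this, ← ih]
        congr 1
        ring
    have hk := hx (-⌊x - α + 1⌋)
    rw [← hper (-⌊x - α + 1⌋)]
    have l1 := Int.floor_le (x - α + 1)
    have l2 := Int.lt_floor_add_one (x - α + 1)
    have hne := hk.2.2
    push_cast at hk hne ⊢
    refine hk.1 ⟨lt_of_le_of_ne (by linarith) (Ne.symm hne), by linarith⟩
  apply Subtype.ext
  change (f : ℝ →ₘ[(volume : Measure ℝ)] 𝕜) = 0
  rw [hF]
  exact AEEqFun.ext (Filter.EventuallyEq.trans hfz AEEqFun.coeFn_zero.symm)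

/-- The norm of `L^p(0, α)` on the space. -/
noncomputable instance instNormBrjunoSpace {𝕜 : Type*} [RCLike 𝕜] {α : Icc (1 / 2 : ℝ) 1}
    {p : ℝ≥0∞} : Norm (brjunoSpace 𝕜 α p) :=
  ⟨fun f => (eLpNorm (f : ℝ →ₘ[(volume : Measure ℝ)] 𝕜) p
    (volume.restrict (Ioo (0 : ℝ) α))).toReal⟩

theorem brjunoSpace_core {𝕜 : Type*} [RCLike 𝕜] {α : Icc (1 / 2 : ℝ) 1} {p : ℝ≥0∞}
    [hp : Fact (1 ≤ p)] : NormedSpace.Core 𝕜 (brjunoSpace 𝕜 α p) where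
  norm_nonneg f := ENNReal.toReal_nonneg
  norm_smul c f := by
    have h0 := ae_restrict_of_ae (s := Ioo (0 : ℝ) α)
      (AEEqFun.coeFn_smul c (f : ℝ →ₘ[(volume : Measure ℝ)] 𝕜))
    change (eLpNorm (c • (f : ℝ →ₘ[(volume : Measure ℝ)] 𝕜) : ℝ →ₘ[(volume : Measure ℝ)] 𝕜) p
      (volume.restrict (Ioo (0 : ℝ) α))).toReal = _
    rw [eLpNorm_congr_ae h0, eLpNorm_const_smul, ENNReal.toReal_mul]
    simp [Norm.norm]
  norm_triangle f g := by
    have h0 := ae_restrict_of_ae (s := Ioo (0 : ℝ) α)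
      (AEEqFun.coeFn_add (f : ℝ →ₘ[(volume : Measure ℝ)] 𝕜) g)
    change (eLpNorm (f + g : ℝ →ₘ[(volume : Measure ℝ)] 𝕜) p
      (volume.restrict (Ioo (0 : ℝ) α))).toReal ≤ _
    rw [eLpNorm_congr_ae h0]
    have hf := f.2.2.2
    have hg := g.2.2.2
    refine (ENNReal.toReal_mono (ENNReal.add_ne_top.2 ⟨hf.2.ne, hg.2.ne⟩)
      (eLpNorm_add_le hf.1 hg.1 hp.out)).trans ?_
    rw [ENNReal.toReal_add hf.2.ne hg.2.ne]
    rfl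
  norm_eq_zero_iff f := by
    have hf := f.2.2.2
    have hp0 : p ≠ 0 := (lt_of_lt_of_le one_pos hp.out).ne'
    constructor
    · intro h
      have h' : eLpNorm (f : ℝ →ₘ[(volume : Measure ℝ)] 𝕜) p
          (volume.restrict (Ioo (0 : ℝ) α)) = 0 :=
        (ENNReal.toReal_eq_zero_iff _).1 h |>.resolve_right hf.2.ne
      exact brjunoSpace_eq_zero f ((eLpNorm_eq_zero_iff hf.1 hp0).1 h')
    · rintro rfl
      have h0 := ae_restrict_of_ae (s := Ioo (0 : ℝ) α)
        (AEEqFun.coeFn_zero (α := ℝ) (β := 𝕜) (μ := volume))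
      change (eLpNorm (0 : ℝ →ₘ[(volume : Measure ℝ)] 𝕜) p
        (volume.restrict (Ioo (0 : ℝ) α))).toReal = 0
      rw [eLpNorm_congr_ae h0]
      simp

noncomputable instance instNormedAddCommGroupBrjunoSpace {𝕜 : Type*} [RCLike 𝕜]
    {α : Icc (1 / 2 : ℝ) 1} {p : ℝ≥0∞} [Fact (1 ≤ p)] :
    NormedAddCommGroup (brjunoSpace 𝕜 α p) :=
  NormedAddCommGroup.ofCore (brjunoSpace_core (𝕜 := 𝕜))

noncomputable instance instNormedSpaceBrjunoSpace {𝕜 : Type*} [RCLike 𝕜]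
    {α : Icc (1 / 2 : ℝ) 1} {p : ℝ≥0∞} [Fact (1 ≤ p)] :
    NormedSpace 𝕜 (brjunoSpace 𝕜 α p) :=
  NormedSpace.ofCore (brjunoSpace_core (𝕜 := 𝕜))

/-- The value `x ↦ x f(1 / x)` of the Brjuno operator, as a relation between two elements of the
space: `g = T f` when `g(x) = x f(1 / x)` for almost every `x ∈ (0, α)`. As an element of the space,
`g` has the parity and periodicity that complete it outside `(0, α)`. -/
def IsBrjunoImage {𝕜 : Type*} [RCLike 𝕜] {α : Icc (1 / 2 : ℝ) 1} {p : ℝ≥0∞}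
    (f g : brjunoSpace 𝕜 α p) : Prop :=
  ∀ᵐ x ∂(volume.restrict (Ioo (0 : ℝ) α)),
    (g : ℝ →ₘ[(volume : Measure ℝ)] 𝕜) x =
      (x : 𝕜) * (f : ℝ →ₘ[(volume : Measure ℝ)] 𝕜) (1 / x)

/-! An element of the space is determined by its restriction to (0, α): almost everywhere it equals
its pullback under the folding map x ↦ |{x}_α|. Hence the space is isometric to L^p(0, α), and T
becomes f ↦ x · f(A x), with A = `cfMap α`. Iterating, T^n f(x) = β_{n-1}(x) f(x_n) almost
everywhere (`coeFn_brjunoOperator_pow`), so the terms of the Brjuno series are exactly the T^n f.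

The norm of T^n is controlled by two facts. Pointwise, β_{n-1} ≤ 4 λ(α)^n (`cfBeta_le`): for α > g =
(√5 - 1)/2 a potential 1 + g x contracts at each step, and for α ≤ g the continuants grow at least
like (1 + √2)^n. Moreover, composition with A^n is bounded on L^p(0, α) uniformly in n
(`eLpNorm_comp_iterate_cfMap_le`), because an explicit density between 1/3 and 4 defines a measure
that A does not increase (`map_cfMap_le`).

Hence ‖T^n‖ ≤ C λ(α)^n. Gelfand's limit bounds the spectral radius, and λ(α) < 1 makes 1 - T
invertible. The solution of B = f + T B is identified with the series by telescoping along the orbit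
(`ae_eq_tsum_brjunoTerm`). -/

/-! ### Folding and the α-continued fraction. -/

theorem alphaFract_eq_sub (α x : ℝ) : alphaFract α x = x - ⌊x - α + 1⌋ := by
  simp only [alphaFract, Int.fract]
  ring

theorem le_alphaFract (α x : ℝ) : α - 1 ≤ alphaFract α x := by
  have := Int.fract_nonneg (x - α + 1)
  simp only [alphaFract]
  linarith

theorem alphaFract_lt (α x : ℝ) : alphaFract α x < α := by
  have := Int.fract_lt_one (x - α + 1)
  simp only [alphaFract]
  linarith

theorem alphaFract_of_mem {α x : ℝ} (h1 : α - 1 ≤ x) (h2 : x < α) : alphaFract α x = x := by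
  rw [alphaFract_eq_sub, Int.floor_eq_zero_iff.2 ⟨by linarith, by linarith⟩]
  simp

theorem alphaFract_add_intCast (α x : ℝ) (k : ℤ) : alphaFract α (x + k) = alphaFract α x := by
  simp only [alphaFract]
  rw [show x + k - α + 1 = x - α + 1 + k by ring, Int.fract_add_intCast]

theorem measurable_alphaFract (α : ℝ) : Measurable (alphaFract α) :=
  ((measurable_fract.comp ((measurable_id.sub_const α).add_const 1)).add_const α).sub_const 1

/-- The representative `|{x}_α|` of `x` modulo translations and the sign. -/
noncomputable def cfFold (α x : ℝ) : ℝ := |alphaFract α x|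

/-- The `α`-continued fraction map `A_α`. -/
noncomputable def cfMap (α x : ℝ) : ℝ := cfFold α x⁻¹

theorem measurable_cfFold (α : ℝ) : Measurable (cfFold α) :=
  continuous_abs.measurable.comp (measurable_alphaFract α)

theorem measurable_cfMap (α : ℝ) : Measurable (cfMap α) :=
  (measurable_cfFold α).comp measurable_inv

theorem cfFold_nonneg (α x : ℝ) : 0 ≤ cfFold α x := abs_nonneg _

theorem cfFold_le {α : ℝ} (hα : 1 / 2 ≤ α) (x : ℝ) : cfFold α x ≤ α :=
  abs_le.2 ⟨by linarith [le_alphaFract α x], (alphaFract_lt α x).le⟩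

theorem cfFold_of_mem {α x : ℝ} (h0 : 0 ≤ x) (h1 : x < α) (hα : α ≤ 1) : cfFold α x = x := by
  rw [cfFold, alphaFract_of_mem (by linarith) h1, abs_of_nonneg h0]

theorem cfFold_of_neg_mem {α x : ℝ} (h0 : 0 ≤ x) (h1 : x < 1 - α) (hα : 1 / 2 ≤ α) :
    cfFold α (-x) = x := by
  rw [cfFold, alphaFract_of_mem (by linarith) (by linarith), abs_neg, abs_of_nonneg h0]

theorem cfFold_add_intCast (α x : ℝ) (k : ℤ) : cfFold α (x + k) = cfFold α x := by
  rw [cfFold, alphaFract_add_intCast, cfFold]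

theorem cfFold_cfFold {α : ℝ} (hα : 1 / 2 ≤ α) (hα1 : α ≤ 1) (x : ℝ) :
    cfFold α (cfFold α x) = cfFold α x := by
  rcases (cfFold_le hα x).lt_or_eq with h | h
  · exact cfFold_of_mem (cfFold_nonneg α x) h hα1
  -- The value α is attained only for α = 1/2, where {x}_α = -1/2 is allowed; there it is still
  -- fixed by the folding.
  · have h2 : α = 1 / 2 := by
      have h3 := le_alphaFract α x
      have h4 := alphaFract_lt α x
      rw [cfFold] at h
      rcases abs_cases (alphaFract α x) with h5 | h5 <;> linarith
    rw [h, cfFold, show alphaFract α α = -(1 / 2) by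
      rw [alphaFract_eq_sub, show ⌊α - α + 1⌋ = 1 by simp, h2]; norm_num, h2]
    norm_num

theorem cfSeq_zero (α x : ℝ) : cfSeq α x 0 = cfFold α x := rfl

theorem cfSeq_succ (α x : ℝ) (n : ℕ) : cfSeq α x (n + 1) = cfMap α (cfSeq α x n) := rfl

theorem cfSeq_nonneg (α x : ℝ) (n : ℕ) : 0 ≤ cfSeq α x n := by
  cases n <;> exact cfFold_nonneg _ _

theorem cfSeq_le {α : ℝ} (hα : 1 / 2 ≤ α) (x : ℝ) (n : ℕ) : cfSeq α x n ≤ α := by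
  cases n <;> exact cfFold_le hα _

theorem cfSeq_eq_iterate (α x : ℝ) (n : ℕ) : cfSeq α x n = (cfMap α)^[n] (cfFold α x) := by
  induction n with
  | zero => rfl
  | succ n ih => rw [cfSeq_succ, ih, Function.iterate_succ_apply']

theorem cfSeq_cfFold {α : ℝ} (hα : 1 / 2 ≤ α) (hα1 : α ≤ 1) (x : ℝ) (n : ℕ) :
    cfSeq α (cfFold α x) n = cfSeq α x n := by
  rw [cfSeq_eq_iterate, cfFold_cfFold hα hα1, cfSeq_eq_iterate]

theorem cfSeq_cfMap {α : ℝ} (hα : 1 / 2 ≤ α) (hα1 : α ≤ 1) (x : ℝ) (n : ℕ) :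
    cfSeq α (cfMap α (cfFold α x)) n = cfSeq α x (n + 1) := by
  rw [cfSeq_eq_iterate, cfMap, cfFold_cfFold hα hα1, cfSeq_eq_iterate, Function.iterate_succ_apply]
  rfl

theorem cfBeta_succ (α x : ℝ) (n : ℕ) : cfBeta α x (n + 1) = cfBeta α x n * cfSeq α x n :=
  Finset.prod_range_succ _ _

theorem cfBeta_nonneg (α x : ℝ) (n : ℕ) : 0 ≤ cfBeta α x n :=
  Finset.prod_nonneg fun i _ => cfSeq_nonneg α x i

theorem cfBeta_cfFold {α : ℝ} (hα : 1 / 2 ≤ α) (hα1 : α ≤ 1) (x : ℝ) (n : ℕ) :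
    cfBeta α (cfFold α x) n = cfBeta α x n :=
  Finset.prod_congr rfl fun i _ => cfSeq_cfFold hα hα1 x i

theorem cfBeta_cfMap {α : ℝ} (hα : 1 / 2 ≤ α) (hα1 : α ≤ 1) (x : ℝ) (n : ℕ) :
    cfFold α x * cfBeta α (cfMap α (cfFold α x)) n = cfBeta α x (n + 1) := by
  simp only [cfBeta, cfSeq_cfMap hα hα1]
  rw [Finset.prod_range_succ', mul_comm, cfSeq_zero]

/-- One step of the `α`-continued fraction: `1 / x = a ± A_α x` with the partial quotient
`a = ⌊1 / x - α + 1⌋`. -/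
theorem cfMap_step (α : ℝ) {x : ℝ} (hx : 0 < x) :
    (x * (⌊x⁻¹ - α + 1⌋ + cfMap α x) = 1 ∧ cfMap α x < α) ∨
      (x * (⌊x⁻¹ - α + 1⌋ - cfMap α x) = 1 ∧ cfMap α x ≤ 1 - α ∧ 0 < cfMap α x) := by
  have h1 := le_alphaFract α x⁻¹
  have h2 := alphaFract_lt α x⁻¹
  have h3 := alphaFract_eq_sub α x⁻¹
  have h4 : x * x⁻¹ = 1 := mul_inv_cancel₀ hx.ne'
  simp only [cfMap, cfFold]
  rcases abs_cases (alphaFract α x⁻¹) with ⟨h5, h6⟩ | ⟨h5, h6⟩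
  · left
    rw [h5]
    refine ⟨?_, h2⟩
    rw [h3, ← h4]
    ring
  · right
    rw [h5]
    refine ⟨?_, by linarith, by linarith⟩
    rw [h3, ← h4]
    ring

/-! ### Exponential decay of the products β. -/

theorem golden_pos : 0 < (Real.sqrt 5 - 1) / 2 := by
  have : (2 : ℝ) < Real.sqrt 5 := by
    rw [Real.lt_sqrt] <;> norm_num
  linarith

theorem golden_lt_one : (Real.sqrt 5 - 1) / 2 < 1 := by
  have : Real.sqrt 5 < 3 := by
    rw [Real.sqrt_lt] <;> norm_num
  linarith

theorem golden_sq : ((Real.sqrt 5 - 1) / 2) ^ 2 = 1 - (Real.sqrt 5 - 1) / 2 := by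
  have : Real.sqrt 5 ^ 2 = 5 := Real.sq_sqrt (by norm_num)
  linear_combination this / 4

theorem silver_pos : 0 < Real.sqrt 2 - 1 := by
  have : (1 : ℝ) < Real.sqrt 2 := by
    rw [Real.lt_sqrt] <;> norm_num
  linarith

theorem silver_lt : Real.sqrt 2 - 1 < 1 / 2 := by
  have : Real.sqrt 2 < 3 / 2 := by
    rw [Real.sqrt_lt] <;> norm_num
  linarith

theorem silver_sq : (Real.sqrt 2 - 1) ^ 2 = 1 - 2 * (Real.sqrt 2 - 1) := by
  have : Real.sqrt 2 ^ 2 = 2 := Real.sq_sqrt (by norm_num)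
  linear_combination this

/-- This makes β_{n-1} (1 + g x_n) shrink by the factor g at each step. For a positive sign, x A(x)
= 1 - a x with a ≥ 1, and a = 1 gives equality because g² = 1 - g. -/
theorem mul_potential_cfMap_le {α g x : ℝ} (hα : 1 / 2 ≤ α) (hα1 : α ≤ 1) (hg : 0 < g)
    (hg2 : g ^ 2 = 1 - g) (hx0 : 0 ≤ x) (hxα : x ≤ α) :
    x * (1 + g * cfMap α x) ≤ g * (1 + g * x) := by
  rcases hx0.eq_or_lt with rfl | hx
  · simp [hg.le]
  have hinv : 1 ≤ x⁻¹ := (one_le_inv₀ hx).2 (hxα.trans hα1)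
  have hk : (1 : ℤ) ≤ ⌊x⁻¹ - α + 1⌋ := Int.le_floor.2 (by push_cast; linarith)
  have hx4 : x * x⁻¹ = 1 := mul_inv_cancel₀ hx.ne'
  rcases cfMap_step α hx with ⟨h1, h2⟩ | ⟨h1, h2, h3⟩
  · have hk' : (1 : ℝ) ≤ ⌊x⁻¹ - α + 1⌋ := by exact_mod_cast hk
    generalize (⌊x⁻¹ - α + 1⌋ : ℝ) = a at *
    have h5 : x * cfMap α x = 1 - a * x := by linear_combination h1
    have h6 : x * (1 + g * cfMap α x) = x + g * (1 - a * x) := by rw [← h5]; ring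
    rw [h6]
    have h7 : g * x * 1 ≤ g * x * a := by gcongr
    have h8 : g * (1 + g * x) = g + (1 - g) * x := by rw [← hg2]; ring
    linarith
  -- A negative sign excludes a = 1: x (1 - A(x)) = 1 is impossible for x ≤ 1 and A(x) > 0.
  · have hk2 : (2 : ℤ) ≤ ⌊x⁻¹ - α + 1⌋ := by
      by_contra hlt
      have : ⌊x⁻¹ - α + 1⌋ = 1 := by omega
      rw [this] at h1
      push_cast at h1
      nlinarith
    have hk' : (2 : ℝ) ≤ ⌊x⁻¹ - α + 1⌋ := by exact_mod_cast hk2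
    generalize (⌊x⁻¹ - α + 1⌋ : ℝ) = a at *
    have h5 : x * cfMap α x = a * x - 1 := by linear_combination -h1
    have h6 : x * (1 + g * cfMap α x) = x + g * (a * x - 1) := by rw [← h5]; ring
    have h7 : x * cfMap α x ≤ x * (1 - α) := by gcongr
    have h8 : g * (1 + g * x) = g + (1 - g) * x := by rw [← hg2]; ring
    -- Equivalent to the goal after `h6` and `h8`. It follows from (a - 1 + α) x ≤ 1, since 2(a -
    -- 1/2) ≥ a + 1 for a ≥ 2.
    have h9 : (a + 1) * x ≤ 2 := by
      have : x * (1 / 2) ≤ x * α := by gcongr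
      nlinarith
    rw [h6, h8]
    nlinarith

theorem cfBeta_le_golden {α g : ℝ} (hα : 1 / 2 ≤ α) (hα1 : α ≤ 1) (hg : 0 < g)
    (hg2 : g ^ 2 = 1 - g) (x : ℝ) (n : ℕ) : cfBeta α x n ≤ 2 * g ^ n := by
  have hg1 : g < 1 := by nlinarith
  have key : cfBeta α x n * (1 + g * cfSeq α x n) ≤ 2 * g ^ n := by
    induction n with
    | zero =>
      have := cfSeq_le hα x 0
      have := cfSeq_nonneg α x 0
      simp only [cfBeta, Finset.range_zero, Finset.prod_empty, pow_zero]
      nlinarith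
    | succ n ih =>
      rw [cfBeta_succ, cfSeq_succ, mul_assoc]
      calc cfBeta α x n * (cfSeq α x n * (1 + g * cfMap α (cfSeq α x n)))
          ≤ cfBeta α x n * (g * (1 + g * cfSeq α x n)) :=
            mul_le_mul_of_nonneg_left (mul_potential_cfMap_le hα hα1 hg hg2 (cfSeq_nonneg α x n)
              (cfSeq_le hα x n)) (cfBeta_nonneg α x n)
        _ = g * (cfBeta α x n * (1 + g * cfSeq α x n)) := by ring
        _ ≤ g * (2 * g ^ n) := by gcongr
        _ = 2 * g ^ (n + 1) := by ring
  have : 0 ≤ cfBeta α x n * (g * cfSeq α x n) :=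
    mul_nonneg (cfBeta_nonneg α x n) (mul_nonneg hg.le (cfSeq_nonneg α x n))
  linarith

/-- The state of the continuants `q = q_n` and `v = ± q_{n-1}` when the remainder is `x`, for
`1 / 2 ≤ α ≤ (√5 - 1) / 2`: the growth of `q` is measured by `q + c v`, except along the runs of
negative signs that follow a partial quotient `2`, where it is measured by `q - c v`. -/
def ContinuantBound (c g G q v x : ℝ) : Prop :=
  0 < q ∧ -q / 2 ≤ v ∧ v ≤ q ∧
    ((G ≤ q + c * v ∧ (1 / 2 < x → 0 ≤ v)) ∨ (G ≤ q - c * v ∧ v ≤ 0 ∧ x ≤ 1 - g))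

/-- The equation c² = 1 - 2c says that q + c v is an eigenfunctional of (q, v) ↦ (2q + v, q) with
eigenvalue 2 + c = 1/c; a larger a only helps. In the second alternative a ≥ 3, and the extra q
absorbs the loss because q + 2v ≥ 0. -/
theorem ContinuantBound.step_pos {c g G q v x y a : ℝ} (hc : 0 < c)
    (hcc : c ^ 2 = 1 - 2 * c) (h : ContinuantBound c g G q v x) (ha2 : 2 ≤ a) (ha3 : x ≤ 1 - g → 3 ≤ a) :
    ContinuantBound c g ((2 + c) * G) (a * q + v) q y := by
  obtain ⟨hq, hv1, hv2, h⟩ := h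
  have haq : 2 * q ≤ a * q := by gcongr
  refine ⟨by linarith, by linarith, by linarith, Or.inl ⟨?_, fun _ => hq.le⟩⟩
  rcases h with ⟨h1, -⟩ | ⟨h1, h2, h3⟩
  · calc (2 + c) * G ≤ (2 + c) * (q + c * v) := by gcongr
      _ = (2 + c) * q + (2 * c + c ^ 2) * v := by ring
      _ = 2 * q + v + c * q := by rw [hcc]; ring
      _ ≤ a * q + v + c * q := by linarith
  · have haq3 : 3 * q ≤ a * q := by gcongr; exact ha3 h3
    calc (2 + c) * G ≤ (2 + c) * (q - c * v) := by gcongr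
      _ = (2 + c) * q - (2 * c + c ^ 2) * v := by ring
      _ = (2 + c) * q - v := by rw [hcc]; ring
      _ ≤ a * q + v + c * q := by linarith

/-- The step is now (q, v) ↦ (aq + v, -q). From the first alternative it loses too much only for a =
2, from the second only for a = 3; in those cases the growth is credited to q - c v. The condition y
≤ 1 - g persists through a run of quotients 3 because 1 - g is the fixed point of x ↦ 1/(3 - x). -/
theorem ContinuantBound.step_neg {c g G q v x y : ℝ} {a : ℤ} (hc : 0 < c) (hc2 : c < 1 / 2)
    (hcc : c ^ 2 = 1 - 2 * c)
    (h : ContinuantBound c g G q v x) (ha2 : 2 ≤ a) (ha3 : x ≤ 1 - g → 3 ≤ a) (hy : y ≤ 1 / 2)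
    (hxa : a = 2 → 1 / 2 < x ∧ y ≤ 1 - g) (hxa3 : a = 3 → x ≤ 1 - g → y ≤ 1 - g) :
    ContinuantBound c g ((2 + c) * G) (a * q + v) (-q) y := by
  obtain ⟨hq, hv1, hv2, h⟩ := h
  have hcq : c * q ≤ 1 / 2 * q := by gcongr
  rcases h with ⟨h1, h2⟩ | ⟨h1, h2, h3⟩
  · have hG : (2 + c) * G ≤ (2 + c) * q + v :=
      calc (2 + c) * G ≤ (2 + c) * (q + c * v) := by gcongr
        _ = (2 + c) * q + (2 * c + c ^ 2) * v := by ring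
        _ = (2 + c) * q + v := by rw [hcc]; ring
    rcases ha2.eq_or_lt with ha | ha
    -- For a = 2 the new q - c v is exactly (2 + c) q + v. The bound -q/2 ≤ v for the new pair
    -- requires the old v to be nonnegative, which is why the invariant records this for x > 1/2.
    · obtain ⟨hx, hy'⟩ := hxa ha.symm
      subst ha
      have hv := h2 hx
      push_cast
      exact ⟨by linarith, by linarith, by linarith, Or.inr ⟨by linarith, by linarith, hy'⟩⟩
    · have ha' : (3 : ℝ) ≤ a := by exact_mod_cast ha
      have haq : 3 * q ≤ a * q := by gcongr
      exact ⟨by linarith, by linarith, by linarith, Or.inl ⟨by linarith, fun h => by linarith⟩⟩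
  · have hG : (2 + c) * G ≤ (2 + c) * q - v :=
      calc (2 + c) * G ≤ (2 + c) * (q - c * v) := by gcongr
        _ = (2 + c) * q - (2 * c + c ^ 2) * v := by ring
        _ = (2 + c) * q - v := by rw [hcc]; ring
    rcases (ha3 h3).eq_or_lt with ha | ha
    · have hy' := hxa3 ha.symm h3
      subst ha
      push_cast
      exact ⟨by linarith, by linarith, by linarith, Or.inr ⟨by linarith, by linarith, hy'⟩⟩
    · have ha' : (4 : ℝ) ≤ a := by exact_mod_cast ha
      have haq : 4 * q ≤ a * q := by gcongr
      exact ⟨by linarith, by linarith, by linarith, Or.inl ⟨by linarith, fun h => by linarith⟩⟩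

/-- The identity β (q + v x) = 1 converts growth of continuants into decay of β. Here α ≤ g gives
1/x ≥ 1 + g, so every partial quotient is at least 2; x ≤ 1 - g gives 1/x ≥ 2 + g, so the quotient
is at least 3. -/
theorem exists_continuantBound {α g c : ℝ} (hα : 1 / 2 ≤ α) (hαg : α ≤ g)
    (hg2 : g ^ 2 = 1 - g) (hc : 0 < c) (hc2 : c < 1 / 2) (hcc : c ^ 2 = 1 - 2 * c) (x : ℝ) (n : ℕ)
    (hβ : cfBeta α x n ≠ 0) :
    ∃ q v : ℝ, ContinuantBound c g ((2 + c) ^ n) q v (cfSeq α x n) ∧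
      cfBeta α x n * (q + v * cfSeq α x n) = 1 := by
  induction n with
  | zero => exact ⟨1, 0, ⟨by norm_num, by norm_num, by norm_num, Or.inl ⟨by simp, by simp⟩⟩,
      by simp [cfBeta]⟩
  | succ n ih =>
    rw [cfBeta_succ] at hβ ⊢
    rw [cfSeq_succ]
    obtain ⟨q, v, h, hqv⟩ := ih (left_ne_zero_of_mul hβ)
    have hx : 0 < cfSeq α x n :=
      lt_of_le_of_ne (cfSeq_nonneg α x n) (right_ne_zero_of_mul hβ).symm
    have hxα : cfSeq α x n ≤ α := cfSeq_le hα x n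
    generalize cfSeq α x n = t at *
    generalize cfBeta α x n = β at *
    have ht4 : t * t⁻¹ = 1 := mul_inv_cancel₀ hx.ne'
    have hinv : 1 + g ≤ t⁻¹ := by
      rw [le_inv_comm₀ (by linarith) hx]
      have : (1 + g)⁻¹ = g := inv_eq_of_mul_eq_one_right (by linarith)
      rw [this]
      linarith
    have ha2 : (2 : ℤ) ≤ ⌊t⁻¹ - α + 1⌋ := Int.le_floor.2 (by push_cast; linarith)
    have hinv3 : t ≤ 1 - g → 2 + g ≤ t⁻¹ := by
      intro h
      rw [le_inv_comm₀ (by linarith) hx]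
      have : (2 + g)⁻¹ = 1 - g := inv_eq_of_mul_eq_one_right (by linarith)
      rwa [this]
    have ha3 : t ≤ 1 - g → (3 : ℤ) ≤ ⌊t⁻¹ - α + 1⌋ := fun h =>
      Int.le_floor.2 (by push_cast; linarith [hinv3 h])
    rw [pow_succ']
    rcases cfMap_step α hx with ⟨h1, h2⟩ | ⟨h1, h2, h3⟩
    · refine ⟨_, _, h.step_pos hc hcc (a := ⌊t⁻¹ - α + 1⌋) (by exact_mod_cast ha2)
        (fun h => by exact_mod_cast ha3 h), ?_⟩
      linear_combination hqv + β * q * h1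
    · have hy : (⌊t⁻¹ - α + 1⌋ : ℝ) - cfMap α t = t⁻¹ := (inv_eq_of_mul_eq_one_right h1).symm
      refine ⟨_, _, h.step_neg hc hc2 hcc ha2 ha3 (by linarith) (fun ha => ?_) (fun ha ht => ?_),
        ?_⟩
      · rw [ha] at hy h1
        push_cast at hy h1
        exact ⟨by nlinarith, by linarith⟩
      · rw [ha] at hy
        push_cast at hy
        linarith [hinv3 ht]
      · linear_combination hqv + β * q * h1

/-- Either alternative gives (2 + c)^n ≤ 2q, and v ≥ -q/2 with x ≤ 1 gives q ≤ 2(q + v x); the two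
factors 2 make the constant 4. The rate is c because (2 + c) c = 1. -/
theorem cfBeta_le_silver {α g c : ℝ} (hα : 1 / 2 ≤ α) (hαg : α ≤ g) (hg1 : g < 1)
    (hg2 : g ^ 2 = 1 - g) (hc : 0 < c) (hc2 : c < 1 / 2) (hcc : c ^ 2 = 1 - 2 * c) (x : ℝ)
    (n : ℕ) : cfBeta α x n ≤ 4 * c ^ n := by
  rcases eq_or_ne (cfBeta α x n) 0 with h0 | h0
  · rw [h0]
    positivity
  obtain ⟨q, v, ⟨hq, hv1, hv2, h⟩, hqv⟩ := exists_continuantBound hα hαg hg2 hc hc2 hcc x n h0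
  have hx0 := cfSeq_nonneg α x n
  have hx1 := (cfSeq_le hα x n).trans (hαg.trans hg1.le)
  have hβ := cfBeta_nonneg α x n
  have hcq : c * q ≤ 1 / 2 * q := by gcongr
  have hG : (2 + c) ^ n ≤ 2 * q := by
    rcases h with ⟨h, -⟩ | ⟨h, -⟩ <;> nlinarith
  have h2 : q / 2 ≤ q + v * cfSeq α x n := by nlinarith
  have h3 : cfBeta α x n * (2 + c) ^ n ≤ 4 := by
    calc cfBeta α x n * (2 + c) ^ n ≤ cfBeta α x n * (2 * q) := by gcongr
      _ ≤ cfBeta α x n * (4 * (q + v * cfSeq α x n)) := mul_le_mul_of_nonneg_left (by linarith) hβ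
      _ = 4 := by linear_combination 4 * hqv
  have h4 : (2 + c) * c = 1 := by linear_combination hcc
  calc cfBeta α x n = cfBeta α x n * ((2 + c) * c) ^ n := by rw [h4]; simp
    _ = cfBeta α x n * (2 + c) ^ n * c ^ n := by rw [mul_pow]; ring
    _ ≤ 4 * c ^ n := by gcongr

theorem brjunoLambda_pos (α : ℝ) : 0 < brjunoLambda α := by
  unfold brjunoLambda
  split_ifs
  exacts [golden_pos, silver_pos]

theorem brjunoLambda_lt_one (α : ℝ) : brjunoLambda α < 1 := by
  unfold brjunoLambda
  split_ifs
  exacts [golden_lt_one, silver_lt.trans (by norm_num)]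

theorem cfBeta_le {α : ℝ} (hα : 1 / 2 ≤ α) (hα1 : α ≤ 1) (x : ℝ) (n : ℕ) :
    cfBeta α x n ≤ 4 * brjunoLambda α ^ n := by
  unfold brjunoLambda
  split_ifs with h
  · refine (cfBeta_le_golden hα hα1 golden_pos golden_sq x n).trans ?_
    have := pow_pos golden_pos n
    linarith
  · exact cfBeta_le_silver hα (not_lt.1 h) golden_lt_one golden_sq silver_pos silver_lt silver_sq x n

/-! ### An explicit density for the α-continued fraction map. -/

/-- The sum `∑ j, h (u + j)` of the transported density `h (u) = u⁻² ρ (1 / u)`. -/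
noncomputable def cfPotential (α u : ℝ) : ℝ :=
  open Classical in
  if (1 - α) * u < 1 then 1 / u
  else if (2 * α - 1) * u < α then 1 / (u - (1 - (Real.sqrt 5 - 1) / 2)) else 1 / (u - 1 / 2)

theorem cfPotential_of_lt {α u : ℝ} (h : (1 - α) * u < 1) : cfPotential α u = 1 / u :=
  if_pos h

theorem cfPotential_of_mid {α u : ℝ} (h : 1 ≤ (1 - α) * u) (h2 : (2 * α - 1) * u < α) :
    cfPotential α u = 1 / (u - (1 - (Real.sqrt 5 - 1) / 2)) := by
  rw [cfPotential, if_neg h.not_gt, if_pos h2]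

theorem cfPotential_of_le {α u : ℝ} (h : 1 ≤ (1 - α) * u) (h2 : α ≤ (2 * α - 1) * u) :
    cfPotential α u = 1 / (u - 1 / 2) := by
  rw [cfPotential, if_neg h.not_gt, if_neg h2.not_gt]

theorem measurable_cfPotential (α : ℝ) : Measurable (cfPotential α) := by
  unfold cfPotential
  refine Measurable.ite ?_ (by fun_prop) (Measurable.ite ?_ (by fun_prop) (by fun_prop))
  · exact measurableSet_lt (by fun_prop) (by fun_prop)
  · exact measurableSet_lt (by fun_prop) (by fun_prop)

theorem half_le_golden : 1 / 2 ≤ (Real.sqrt 5 - 1) / 2 := by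
  have : (2 : ℝ) < Real.sqrt 5 := by
    rw [Real.lt_sqrt] <;> norm_num
  linarith

theorem one_div_le_cfPotential {α u : ℝ} (hu : 1 ≤ u) : 1 / u ≤ cfPotential α u := by
  have h1 := half_le_golden
  have h2 := golden_lt_one
  unfold cfPotential
  split_ifs
  · exact le_rfl
  · exact one_div_le_one_div_of_le (by linarith) (by linarith)
  · exact one_div_le_one_div_of_le (by linarith) (by linarith)

theorem cfPotential_le_two {α u : ℝ} (hu : 1 ≤ u) : cfPotential α u ≤ 2 := by
  have h1 := half_le_golden
  unfold cfPotential
  split_ifs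
  all_goals
    rw [div_le_iff₀ (by linarith)]
    linarith

/-- Write φ for `cfPotential α`. Since the transported density is φ(u) - φ(u + 1), sums over
translates telescope, and invariance becomes y² (φ(y + k) + φ(l - y)) = φ(1/y) - φ(1/y + 1), where y
+ k and l - y are the first translates beyond 1/α and the second term occurs only for y < 1 - α.
Inserting the intermediate value y separates the two signs, which gives one identity per sign and
per value of k or l. -/
theorem sq_mul_cfPotential_one_add {α y : ℝ} (hα1 : α ≤ 1) (hy : 0 < y) (hyα : y < α)
    (h : 1 - α < α * y) : y ^ 2 * cfPotential α (1 + y) = y - cfPotential α (1 / y + 1) := by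
  have hyu : y * (1 / y) = 1 := mul_one_div_cancel hy.ne'
  have hu : 0 < 1 / y := by positivity
  have h1 := mul_lt_mul_of_pos_right h hu
  rw [cfPotential_of_lt (by nlinarith), cfPotential_of_lt (by nlinarith)]
  field_simp
  ring

theorem sq_mul_cfPotential_two_add {α y : ℝ} (hα : 1 / 2 ≤ α) (hα1 : α ≤ 1) (hy : 0 < y)
    (hyα : y < α) (h : α * y < 1 - α) (hne : (1 - α) * y ≠ 2 * α - 1) :
    y ^ 2 * cfPotential α (2 + y) = y - cfPotential α (1 / y + 1) := by
  have hyu : y * (1 / y) = 1 := mul_one_div_cancel hy.ne'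
  have hu : 0 < 1 / y := by positivity
  have h1 := mul_lt_mul_of_pos_right h hu
  have h2 : 1 ≤ (1 - α) * (1 / y + 1) := by nlinarith
  rcases lt_or_gt_of_ne hne with h3 | h3
  · have h4 := mul_lt_mul_of_pos_right h3 hu
    rw [cfPotential_of_lt (by nlinarith), cfPotential_of_le h2 (by nlinarith)]
    have e1 : 1 / y + 1 - 1 / 2 ≠ 0 := by linarith
    have e2 : 1 / (1 / y + 1 - 1 / 2) = 2 * y / (2 + y) := by
      rw [div_eq_div_iff e1 (by positivity)]
      linear_combination -2 * hyu
    rw [e2]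
    field_simp
    ring
  · have h4 := mul_lt_mul_of_pos_right h3 hu
    -- The middle branch of the potential is reached only for α ≤ g. There 1/(1 + g) = g makes the
    -- identity close up.
    have h5 : α ^ 2 + α ≤ 1 := by
      have := mul_lt_mul_of_pos_left h3 (show 0 < α by linarith)
      have := mul_le_mul_of_nonneg_left h.le (show 0 ≤ 1 - α by linarith)
      nlinarith
    have h6 : (2 * α - 1) * (2 + y) < α := by
      rcases hα.eq_or_lt with h7 | h7
      · rw [← h7]
        norm_num
      · have := mul_lt_mul_of_pos_left hyα (show 0 < 2 * α - 1 by linarith)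
        nlinarith
    rw [cfPotential_of_mid (by nlinarith) h6, cfPotential_of_mid h2 (by nlinarith)]
    have hg := golden_sq
    have hg0 := golden_pos
    generalize (Real.sqrt 5 - 1) / 2 = g at *
    have e1 : 2 + y - (1 - g) ≠ 0 := by linarith
    have e2 : 1 / y + 1 - (1 - g) ≠ 0 := by linarith
    have e3 : y - 1 / (1 / y + 1 - (1 - g)) = y - y / (1 + g * y) := by
      congr 1
      rw [div_eq_div_iff e2 (by positivity)]
      linear_combination -hyu
    have e4 : 1 + g * y ≠ 0 := by positivity
    have e5 : 1 / (2 + y - (1 - g)) = g / (1 + g * y) := by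
      rw [div_eq_div_iff e1 e4]
      linear_combination -hg
    rw [e3, e5]
    field_simp
    ring

theorem sq_mul_cfPotential_two_sub {α y : ℝ} (hα : 1 / 2 ≤ α) (hy : 0 < y)
    (hyα : y < 1 - α) (h : α * y < 2 * α - 1) :
    y ^ 2 * cfPotential α (2 - y) = cfPotential α (1 / y) - y := by
  have hyu : y * (1 / y) = 1 := mul_one_div_cancel hy.ne'
  have hu : 0 < 1 / y := by positivity
  have h1 := mul_lt_mul_of_pos_right h hu
  have h2 := mul_lt_mul_of_pos_right hyα hu
  rw [cfPotential_of_lt (by nlinarith), cfPotential_of_le (by linarith) (by nlinarith)]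
  have e1 : 2 - y ≠ 0 := by linarith
  have e2 : 1 / y - 1 / 2 ≠ 0 := by nlinarith
  have e3 : 1 / (1 / y - 1 / 2) = 2 * y / (2 - y) := by
    rw [div_eq_div_iff e2 e1]
    linear_combination -2 * hyu
  rw [e3]
  field_simp
  ring

theorem sq_mul_cfPotential_three_sub {α y : ℝ} (hα : 1 / 2 ≤ α) (hy : 0 < y)
    (hyα : y < 1 - α) (h : 2 * α - 1 < α * y) :
    y ^ 2 * cfPotential α (3 - y) = cfPotential α (1 / y) - y := by
  have hyu : y * (1 / y) = 1 := mul_one_div_cancel hy.ne'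
  have hu : 0 < 1 / y := by positivity
  have h1 := mul_lt_mul_of_pos_right h hu
  have h2 := mul_lt_mul_of_pos_right hyα hu
  have h5 : α ^ 2 + α ≤ 1 := by nlinarith
  have h6 : (2 * α - 1) * (3 - y) < α := by
    rcases hα.eq_or_lt with h7 | h7
    · rw [← h7]
      norm_num
    · have h8 := mul_lt_mul_of_pos_left h (show 0 < 2 * α - 1 by linarith)
      have h9 : α * ((2 * α - 1) * (3 - y)) < α * α := by nlinarith
      exact lt_of_mul_lt_mul_left h9 (by linarith)
  rw [cfPotential_of_mid (by nlinarith) h6, cfPotential_of_mid (by linarith) (by nlinarith)]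
  have hg := golden_sq
  have hg0 := half_le_golden
  have hg1 := golden_lt_one
  generalize (Real.sqrt 5 - 1) / 2 = g at *
  have e1 : 3 - y - (1 - g) ≠ 0 := by linarith
  have e5 : (1 : ℝ) < 1 / y := by
    rw [lt_div_iff₀ hy]
    linarith
  have e2 : 1 / y - (1 - g) ≠ 0 := by linarith
  have e4 : 1 - (1 - g) * y ≠ 0 := by nlinarith
  have e3 : 1 / (1 / y - (1 - g)) = y / (1 - (1 - g) * y) := by
    rw [div_eq_div_iff e2 e4]
    linear_combination -hyu
  have e6 : 1 / (3 - y - (1 - g)) = (1 - g) / (1 - (1 - g) * y) := by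
    rw [div_eq_div_iff e1 e4]
    linear_combination hg
  rw [e3, e6, ← mul_div_assoc, eq_sub_iff_add_eq, div_add' _ _ _ e4]
  congr 1
  ring

theorem cfPotential_one_div {α y : ℝ} (hy : 0 < y) (hyα : 1 - α < y) :
    cfPotential α (1 / y) = y := by
  have hyu : y * (1 / y) = 1 := mul_one_div_cancel hy.ne'
  have hu : 0 < 1 / y := by positivity
  have h2 := mul_lt_mul_of_pos_right hyα hu
  rw [cfPotential_of_lt (by linarith), one_div_one_div]

/-- `y` is not one of the points of discontinuity of the density. -/
def IsDensityContinuityPoint (α y : ℝ) : Prop :=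
  α * y ≠ 1 - α ∧ (1 - α) * y ≠ 2 * α - 1 ∧ α * y ≠ 2 * α - 1 ∧ y ≠ 1 - α

theorem isDensityContinuityPoint_of_ne {α y : ℝ} (hα : α ≠ 0) (h1 : y ≠ (1 - α) / α)
    (h2 : y ≠ (2 * α - 1) / (1 - α)) (h3 : y ≠ (2 * α - 1) / α) (h4 : y ≠ 1 - α) :
    IsDensityContinuityPoint α y := by
  refine ⟨fun h => h1 ?_, fun h => ?_, fun h => h3 ?_, h4⟩
  · rw [← h, mul_div_cancel_left₀ _ hα]
  · rcases eq_or_ne (1 - α) 0 with h5 | h5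
    · rw [h5] at h
      linarith
    · exact h2 (by rw [← h, mul_div_cancel_left₀ _ h5])
  · rw [← h, mul_div_cancel_left₀ _ hα]

theorem ae_isDensityContinuityPoint {α : ℝ} (hα : 1 / 2 ≤ α) :
    ∀ᵐ y : ℝ, IsDensityContinuityPoint α y := by
  filter_upwards [Measure.ae_ne volume ((1 - α) / α), Measure.ae_ne volume ((2 * α - 1) / (1 - α)),
    Measure.ae_ne volume ((2 * α - 1) / α), Measure.ae_ne volume (1 - α)] with y h1 h2 h3 h4
  exact isDensityContinuityPoint_of_ne (by linarith) h1 h2 h3 h4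

/-- The first translate beyond 1/α has k = 1 or 2, according to the sign of αy - (1 - α). -/
theorem exists_sq_mul_cfPotential_add {α y : ℝ} (hα : 1 / 2 ≤ α) (hα1 : α ≤ 1) (hy : 0 < y)
    (hyα : y < α) (hgen : IsDensityContinuityPoint α y) : ∃ k : ℤ, 1 ≤ k ∧ k ≤ 2 ∧ α⁻¹ < y + k ∧
      y + k - 1 ≤ α⁻¹ ∧ y ^ 2 * cfPotential α (y + k) = y - cfPotential α (1 / y + 1) := by
  have hα0 : 0 < α := by linarith
  rcases lt_or_gt_of_ne hgen.1 with h | h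
  · refine ⟨2, by norm_num, by norm_num, ?_, ?_, ?_⟩
    · rw [inv_eq_one_div, div_lt_iff₀ hα0]
      push_cast
      nlinarith
    · rw [inv_eq_one_div, le_div_iff₀ hα0]
      push_cast
      nlinarith
    · rw [← sq_mul_cfPotential_two_add hα hα1 hy hyα h hgen.2.1]
      push_cast
      rw [add_comm]
  · refine ⟨1, by norm_num, by norm_num, ?_, ?_, ?_⟩
    · rw [inv_eq_one_div, div_lt_iff₀ hα0]
      push_cast
      nlinarith
    · have : 1 ≤ α⁻¹ := (one_le_inv₀ hα0).2 hα1
      push_cast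
      linarith
    · rw [← sq_mul_cfPotential_one_add hα1 hy hyα h]
      push_cast
      rw [add_comm]

theorem exists_sq_mul_cfPotential_sub {α y : ℝ} (hα : 1 / 2 ≤ α) (hα1 : α ≤ 1) (hy : 0 < y)
    (hyα : y < 1 - α) (hgen : IsDensityContinuityPoint α y) : ∃ k : ℤ, 2 ≤ k ∧ α⁻¹ < -y + k ∧
      -y + k - 1 ≤ α⁻¹ ∧ y ^ 2 * cfPotential α (-y + k) = cfPotential α (1 / y) - y := by
  have hα0 : 0 < α := by linarith
  rcases lt_or_gt_of_ne hgen.2.2.1 with h | h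
  · refine ⟨2, le_rfl, ?_, ?_, ?_⟩
    · rw [inv_eq_one_div, div_lt_iff₀ hα0]
      push_cast
      nlinarith
    · have : 1 ≤ α⁻¹ := (one_le_inv₀ hα0).2 hα1
      push_cast
      linarith
    · rw [← sq_mul_cfPotential_two_sub hα hy hyα h]
      push_cast
      rw [neg_add_eq_sub]
  · refine ⟨3, by norm_num, ?_, ?_, ?_⟩
    · rw [inv_eq_one_div, div_lt_iff₀ hα0]
      push_cast
      nlinarith
    · rw [inv_eq_one_div, le_div_iff₀ hα0]
      push_cast
      nlinarith
    · rw [← sq_mul_cfPotential_three_sub hα hy hyα h]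
      push_cast
      rw [neg_add_eq_sub]

/-- A multiple of the invariant density of `A_α` on `(0, α)`. -/
noncomputable def cfDensity (α y : ℝ) : ℝ :=
  (cfPotential α (1 / y) - cfPotential α (1 / y + 1)) / y ^ 2

theorem measurable_cfDensity (α : ℝ) : Measurable (cfDensity α) := by
  have := measurable_cfPotential α
  unfold cfDensity
  fun_prop

/-- Since φ(1/y) ≥ y, the density is at least φ(y + k) ≥ 1/(y + k), and y + k ≤ 3. -/
theorem le_cfDensity {α y : ℝ} (hα : 1 / 2 ≤ α) (hα1 : α ≤ 1) (hy : 0 < y)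
    (hyα : y < α) (hgen : IsDensityContinuityPoint α y) : 1 / 3 ≤ cfDensity α y := by
  obtain ⟨k, hk, hk2, -, -, h⟩ := exists_sq_mul_cfPotential_add hα hα1 hy hyα hgen
  have hk' : (1 : ℝ) ≤ k := by exact_mod_cast hk
  have hk2' : (k : ℝ) ≤ 2 := by exact_mod_cast hk2
  have h1 : y ≤ cfPotential α (1 / y) := by
    have := one_div_le_cfPotential (α := α) ((one_le_div hy).2 (hyα.le.trans hα1))
    rwa [one_div_one_div] at this
  have h2 : 1 / 3 ≤ cfPotential α (y + k) :=
    (one_div_le_one_div_of_le (by linarith) (by linarith)).trans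
      (one_div_le_cfPotential (by linarith))
  rw [cfDensity, le_div_iff₀ (by positivity)]
  have : y ^ 2 * (1 / 3) ≤ y ^ 2 * cfPotential α (y + k) := by gcongr
  linarith

theorem cfDensity_le {α y : ℝ} (hα : 1 / 2 ≤ α) (hα1 : α ≤ 1) (hy : 0 < y)
    (hyα : y < α) (hgen : IsDensityContinuityPoint α y) : cfDensity α y ≤ 4 := by
  obtain ⟨k, hk, hk2, -, -, h⟩ := exists_sq_mul_cfPotential_add hα hα1 hy hyα hgen
  have hk' : (1 : ℝ) ≤ k := by exact_mod_cast hk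
  have h1 : y ^ 2 * cfPotential α (y + k) ≤ y ^ 2 * 2 := by
    gcongr
    exact cfPotential_le_two (by linarith)
  rw [cfDensity, div_le_iff₀ (by positivity)]
  rcases lt_or_gt_of_ne hgen.2.2.2 with h3 | h3
  · obtain ⟨k, hk, -, -, h4⟩ := exists_sq_mul_cfPotential_sub hα hα1 hy h3 hgen
    have hk' : (2 : ℝ) ≤ k := by exact_mod_cast hk
    have h5 : y ^ 2 * cfPotential α (-y + k) ≤ y ^ 2 * 2 := by
      gcongr
      exact cfPotential_le_two (by linarith)
    linarith
  · rw [cfPotential_one_div hy h3]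
    nlinarith

/-! ### Sub-invariance of the measure. -/

theorem tsum_indicator_sub_le {φ : ℝ → ℝ} {c y : ℝ} {k₀ : ℤ} (hφ : ∀ u, c < u → 0 ≤ φ u)
    (hk : c < y + k₀) (hc : y + k₀ - 1 ≤ c)
    (hmono : ∀ k : ℤ, c < y + k → φ (y + k + 1) ≤ φ (y + k)) :
    ∑' k : ℤ, (Ioi c).indicator (fun u => ENNReal.ofReal (φ u - φ (u + 1))) (y + k) ≤
      ENNReal.ofReal (φ (y + k₀)) := by
  have hinj : Function.Injective (fun j : ℕ => k₀ + (j : ℤ)) := fun i j h => by simpa using h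
  rw [← hinj.tsum_eq]
  · refine ENNReal.tsum_le_of_sum_range_le fun n => ?_
    -- Keeping the remainder φ(y + k₀ + n) on the left makes the telescoping additive in `ℝ≥0∞`;
    -- monotonicity ensures that `ENNReal.ofReal` truncates nothing.
    have : ∀ n : ℕ, ∑ j ∈ Finset.range n,
        (Ioi c).indicator (fun u => ENNReal.ofReal (φ u - φ (u + 1))) (y + ((k₀ + j : ℤ) : ℝ)) +
          ENNReal.ofReal (φ (y + k₀ + n)) ≤ ENNReal.ofReal (φ (y + k₀)) := by
      intro n
      induction n with
      | zero => simp
      | succ n ih =>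
        refine le_trans (le_of_eq ?_) ih
        have h1 : c < y + ((k₀ + n : ℤ) : ℝ) := by
          push_cast
          linarith [n.cast_nonneg (α := ℝ)]
        have h2 := hmono _ h1
        have h3 := hφ (y + ((k₀ + n : ℤ) : ℝ) + 1) (by linarith)
        rw [Finset.sum_range_succ, indicator_of_mem (mem_Ioi.2 h1), add_assoc]
        congr 1
        rw [show y + k₀ + ((n + 1 : ℕ) : ℝ) = y + ((k₀ + n : ℤ) : ℝ) + 1 by push_cast; ring,
          show y + k₀ + (n : ℝ) = y + ((k₀ + n : ℤ) : ℝ) by push_cast; ring,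
          ← ENNReal.ofReal_add (by linarith) h3, sub_add_cancel]
    exact le_self_add.trans (this n)
  · intro k hk'
    have h1 : y + k ∈ Ioi c := by
      by_contra h
      exact hk' (indicator_of_notMem h _)
    rw [mem_Ioi] at h1
    have h2 : (k₀ : ℝ) - 1 < k := by linarith
    have h3 : k₀ - 1 < k := by exact_mod_cast h2
    exact ⟨(k - k₀).toNat, by simp only []; omega⟩

/-- This is positivity of the density at y = 1/u. -/
theorem cfPotential_add_one_le {α u : ℝ} (hα : 1 / 2 ≤ α) (hα1 : α ≤ 1) (hu : α⁻¹ < u)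
    (hgen : IsDensityContinuityPoint α u⁻¹) : cfPotential α (u + 1) ≤ cfPotential α u := by
  have hα0 : 0 < α := by linarith
  have hu0 : 0 < u := (inv_pos.2 hα0).trans hu
  have hy : 0 < u⁻¹ := inv_pos.2 hu0
  have h := le_cfDensity hα hα1 hy (inv_lt_of_inv_lt₀ hα0 hu) hgen
  rw [cfDensity, le_div_iff₀ (by positivity), one_div u⁻¹, inv_inv] at h
  nlinarith [sq_nonneg u⁻¹]

/-- The density transported to `(1 / α, ∞)` by `x ↦ 1 / x`. -/
noncomputable def cfInvDensity (α : ℝ) : ℝ → ℝ≥0∞ :=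
  (Ioi α⁻¹).indicator fun u => ENNReal.ofReal (cfPotential α u - cfPotential α (u + 1))

theorem measurable_cfInvDensity (α : ℝ) : Measurable (cfInvDensity α) := by
  have := measurable_cfPotential α
  exact Measurable.indicator (by fun_prop) measurableSet_Ioi

theorem tsum_cfInvDensity_le {α y : ℝ} (hα : 1 / 2 ≤ α) (hα1 : α ≤ 1) (hy : 0 < y)
    (hyα : y < α) (hgen : IsDensityContinuityPoint α y)
    (hgen' : ∀ k : ℤ, IsDensityContinuityPoint α (y + k)⁻¹)
    (hgen'' : ∀ k : ℤ, IsDensityContinuityPoint α (-y + k)⁻¹) :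
    ∑' k : ℤ, cfInvDensity α (y + k) +
      (Ioo 0 (1 - α)).indicator (fun y => ∑' k : ℤ, cfInvDensity α (-y + k)) y ≤
      ENNReal.ofReal (cfDensity α y) := by
  have hα0 : 0 < α := by linarith
  have h1 : 1 ≤ α⁻¹ := (one_le_inv₀ hα0).2 hα1
  have hφ : ∀ u, α⁻¹ < u → 0 ≤ cfPotential α u := fun u hu =>
    (one_div_pos.2 (by linarith)).le.trans (one_div_le_cfPotential (by linarith))
  obtain ⟨k, -, -, hk1, hk2, hk3⟩ := exists_sq_mul_cfPotential_add hα hα1 hy hyα hgen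
  have e1 := tsum_indicator_sub_le hφ hk1 hk2 fun j hj =>
    cfPotential_add_one_le hα hα1 hj (hgen' j)
  rcases lt_or_gt_of_ne hgen.2.2.2 with h3 | h3
  · obtain ⟨l, -, hl1, hl2, hl3⟩ := exists_sq_mul_cfPotential_sub hα hα1 hy h3 hgen
    have e2 := tsum_indicator_sub_le hφ hl1 hl2 fun j hj =>
      cfPotential_add_one_le hα hα1 hj (hgen'' j)
    rw [indicator_of_mem (mem_Ioo.2 ⟨hy, h3⟩)]
    refine (add_le_add e1 e2).trans (le_of_eq ?_)
    rw [← ENNReal.ofReal_add (hφ _ hk1) (hφ _ hl1), cfDensity]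
    congr 1
    rw [eq_div_iff (by positivity)]
    linear_combination hk3 + hl3
  · rw [indicator_of_notMem fun h => h3.not_gt h.2, add_zero]
    refine e1.trans (le_of_eq ?_)
    rw [cfDensity, cfPotential_one_div hy h3, ← hk3, mul_div_cancel_left₀ _ (by positivity)]

theorem lintegral_cfMap_mul_cfDensity {α : ℝ} (hα : 0 < α) (G : ℝ → ℝ≥0∞) :
    ∫⁻ x in Ioo 0 α, G (cfMap α x) * ENNReal.ofReal (cfDensity α x) =
      ∫⁻ u, G (cfFold α u) * cfInvDensity α u := by
  have himg : (fun x : ℝ => x⁻¹) '' Ioo 0 α = Ioi α⁻¹ := by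
    ext u
    constructor
    · rintro ⟨x, hx, rfl⟩
      exact inv_strictAnti₀ hx.1 hx.2
    · intro hu
      have hu0 : 0 < u := (inv_pos.2 hα).trans hu
      exact ⟨u⁻¹, ⟨inv_pos.2 hu0, inv_lt_of_inv_lt₀ hα hu⟩, inv_inv u⟩
  have h := lintegral_image_eq_lintegral_abs_deriv_mul (s := Ioo 0 α) (f := fun x : ℝ => x⁻¹)
    (f' := fun x => -(x ^ 2)⁻¹) measurableSet_Ioo
    (fun x hx => (hasDerivAt_inv hx.1.ne').hasDerivWithinAt) inv_injective.injOn
    (fun u => G (cfFold α u) * ENNReal.ofReal (cfPotential α u - cfPotential α (u + 1)))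
  rw [himg, ← lintegral_indicator measurableSet_Ioi] at h
  have e : (fun u => G (cfFold α u) * cfInvDensity α u) = (Ioi α⁻¹).indicator
      (fun u => G (cfFold α u) * ENNReal.ofReal (cfPotential α u - cfPotential α (u + 1))) := by
    ext u
    rw [indicator_mul_right]
    rfl
  rw [e, h]
  refine setLIntegral_congr_fun measurableSet_Ioo fun x hx => ?_
  simp only [abs_neg, cfMap, cfDensity, one_div]
  rw [abs_of_nonneg (by positivity), div_eq_inv_mul, ENNReal.ofReal_mul (by positivity)]
  ring

theorem exists_int_sub_mem_Ioo (α : ℝ) : ∀ᵐ u : ℝ, ∃ k : ℤ,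
    u - k ∈ Ioo 0 α ∨ k - u ∈ Ioo 0 (1 - α) := by
  have h : ∀ᵐ u : ℝ, ∀ k : ℤ, u ≠ k ∧ u ≠ α - 1 + k := by
    rw [ae_all_iff]
    exact fun k => (Measure.ae_ne volume _).and (Measure.ae_ne volume _)
  filter_upwards [h] with u hu
  refine ⟨⌊u - α + 1⌋, ?_⟩
  have h1 := alphaFract_eq_sub α u
  have h2 := alphaFract_lt α u
  have h3 := le_alphaFract α u
  obtain ⟨h4, h5⟩ := hu ⌊u - α + 1⌋
  rcases lt_or_gt_of_ne h4 with h6 | h6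
  · right
    refine ⟨by linarith, lt_of_le_of_ne (by linarith) fun h7 => h5 (by linarith)⟩
  · left
    exact ⟨by linarith, by linarith⟩

/-- Almost every u is y + k with y ∈ (0, α) or -y + k with y ∈ (0, 1 - α), and folds to y. `P` and
`N` collect these two kinds of pieces; covering the line is enough for an upper bound. -/
theorem lintegral_cfFold_le {α : ℝ} (hα : 1 / 2 ≤ α) (hα1 : α ≤ 1) {G H : ℝ → ℝ≥0∞}
    (hG : Measurable G) (hH : Measurable H) :
    ∫⁻ u, G (cfFold α u) * H u ≤ ∫⁻ y in Ioo 0 α, G y * (∑' k : ℤ, H (y + k) +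
      (Ioo 0 (1 - α)).indicator (fun y => ∑' k : ℤ, H (-y + k)) y) := by
  set F : ℝ → ℝ≥0∞ := fun u => G (cfFold α u) * H u
  have hFm : Measurable F := (hG.comp (measurable_cfFold α)).mul hH
  let P : ℤ → ℝ → ℝ≥0∞ := fun k => (Ioo 0 α).indicator fun y => F (y + k)
  let N : ℤ → ℝ → ℝ≥0∞ := fun k => (Ioo 0 (1 - α)).indicator fun y => F (-y + k)
  have hP : ∀ k, Measurable (P k) := fun k => Measurable.indicator (by fun_prop) measurableSet_Ioo
  have hN : ∀ k, Measurable (N k) := fun k => Measurable.indicator (by fun_prop) measurableSet_Ioo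
  calc ∫⁻ u, F u ≤ ∫⁻ u, (∑' k : ℤ, P k (u - k) + ∑' k : ℤ, N k (k - u)) := by
        refine lintegral_mono_ae ?_
        filter_upwards [exists_int_sub_mem_Ioo α] with u ⟨k, hk⟩
        rcases hk with hk | hk
        · refine le_trans ?_ (le_self_add.trans' (ENNReal.le_tsum k))
          simp only [P]
          rw [indicator_of_mem hk, sub_add_cancel]
        · refine le_trans ?_ (le_add_self.trans' (ENNReal.le_tsum k))
          simp only [N]
          rw [indicator_of_mem hk, neg_sub, sub_add_cancel]
    _ = ∫⁻ y, (∑' k : ℤ, P k y + ∑' k : ℤ, N k y) := by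
        rw [lintegral_add_left (by fun_prop), lintegral_add_left (by fun_prop),
          lintegral_tsum (fun k => by fun_prop), lintegral_tsum (fun k => by fun_prop),
          lintegral_tsum (fun k => by fun_prop), lintegral_tsum (fun k => by fun_prop)]
        congr 2
        · ext k
          exact lintegral_sub_right_eq_self (P k) (k : ℝ)
        · ext k
          exact lintegral_sub_left_eq_self (N k) (k : ℝ)
    _ = _ := by
        rw [← lintegral_indicator measurableSet_Ioo]
        refine lintegral_congr fun y => ?_
        by_cases hy : y ∈ Ioo 0 α
        · rw [indicator_of_mem hy, mul_add, ← ENNReal.tsum_mul_left]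
          congr 1
          · refine tsum_congr fun k => ?_
            simp only [P, F]
            rw [indicator_of_mem hy, cfFold_add_intCast, cfFold_of_mem hy.1.le hy.2 hα1]
          · by_cases hy' : y ∈ Ioo 0 (1 - α)
            · rw [indicator_of_mem hy', ← ENNReal.tsum_mul_left]
              refine tsum_congr fun k => ?_
              simp only [N, F]
              rw [indicator_of_mem hy', cfFold_add_intCast, cfFold_of_neg_mem hy'.1.le hy'.2 hα]
            · simp [N, hy']
        · have hy' : y ∉ Ioo 0 (1 - α) := fun h => hy ⟨h.1, by linarith [h.2]⟩
          simp [P, N, hy, hy']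

/-- The measure `ρ dx` on `(0, α)`. -/
noncomputable def cfMeasure (α : ℝ) : Measure ℝ :=
  (volume.restrict (Ioo 0 α)).withDensity fun x => ENNReal.ofReal (cfDensity α x)

theorem lintegral_cfMeasure (α : ℝ) {G : ℝ → ℝ≥0∞} (hG : Measurable G) :
    ∫⁻ x, G x ∂(cfMeasure α) = ∫⁻ x in Ioo 0 α, G x * ENNReal.ofReal (cfDensity α x) := by
  rw [cfMeasure, lintegral_withDensity_eq_lintegral_mul _
    (measurable_cfDensity α).ennreal_ofReal hG]
  simp only [Pi.mul_apply, mul_comm]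

theorem ae_isDensityContinuityPoint_inv {α : ℝ} (hα : 1 / 2 ≤ α) :
    ∀ᵐ u : ℝ, IsDensityContinuityPoint α u⁻¹ := by
  filter_upwards [Measure.ae_ne volume ((1 - α) / α)⁻¹,
    Measure.ae_ne volume ((2 * α - 1) / (1 - α))⁻¹, Measure.ae_ne volume ((2 * α - 1) / α)⁻¹,
    Measure.ae_ne volume (1 - α)⁻¹] with y h1 h2 h3 h4
  exact isDensityContinuityPoint_of_ne (by linarith) (fun h => h1 (by rw [← h, inv_inv]))
    (fun h => h2 (by rw [← h, inv_inv])) (fun h => h3 (by rw [← h, inv_inv]))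
    (fun h => h4 (by rw [← h, inv_inv]))

/-- The substitution u = 1/x, the folding and the telescoped identity combine. An inequality
suffices, since it passes to all iterates. -/
theorem map_cfMap_le {α : ℝ} (hα : 1 / 2 ≤ α) (hα1 : α ≤ 1) :
    (cfMeasure α).map (cfMap α) ≤ cfMeasure α := by
  refine Measure.le_iff.2 fun s hs => ?_
  have hG : Measurable (s.indicator (1 : ℝ → ℝ≥0∞)) := measurable_one.indicator hs
  rw [← lintegral_indicator_one hs, ← lintegral_indicator_one hs,
    lintegral_map hG (measurable_cfMap α),
    lintegral_cfMeasure α (G := fun x => s.indicator 1 (cfMap α x))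
      (hG.comp (measurable_cfMap α)), lintegral_cfMeasure α hG,
    lintegral_cfMap_mul_cfDensity (by linarith)]
  refine (lintegral_cfFold_le hα hα1 hG (measurable_cfInvDensity α)).trans ?_
  have hinv := ae_isDensityContinuityPoint_inv hα
  have h1 : ∀ᵐ y : ℝ, ∀ k : ℤ, IsDensityContinuityPoint α (y + k)⁻¹ :=
    ae_all_iff.2 fun k => (measurePreserving_add_right volume (k : ℝ)).quasiMeasurePreserving.ae hinv
  have h2 : ∀ᵐ y : ℝ, ∀ k : ℤ, IsDensityContinuityPoint α (-y + k)⁻¹ :=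
    (Measure.measurePreserving_neg volume).quasiMeasurePreserving.ae h1
  refine lintegral_mono_ae ?_
  rw [ae_restrict_iff' measurableSet_Ioo]
  filter_upwards [ae_isDensityContinuityPoint hα, h1, h2] with y h3 h4 h5 hy
  gcongr
  exact tsum_cfInvDensity_le hα hα1 hy.1 hy.2 h3 h4 h5

theorem volume_restrict_le_cfMeasure {α : ℝ} (hα : 1 / 2 ≤ α) (hα1 : α ≤ 1) :
    volume.restrict (Ioo 0 α) ≤ (3 : ℝ≥0∞) • cfMeasure α := by
  rw [cfMeasure, ← withDensity_smul _ (measurable_cfDensity α).ennreal_ofReal]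
  conv_lhs => rw [← withDensity_one (μ := volume.restrict (Ioo 0 α))]
  refine withDensity_mono ?_
  rw [Filter.EventuallyLE, ae_restrict_iff' measurableSet_Ioo]
  filter_upwards [ae_isDensityContinuityPoint hα] with y h hy
  have := le_cfDensity hα hα1 hy.1 hy.2 h
  simp only [Pi.one_apply, Pi.smul_apply, smul_eq_mul]
  rw [← ENNReal.ofReal_one, ← ENNReal.ofReal_ofNat, ← ENNReal.ofReal_mul (by norm_num)]
  exact ENNReal.ofReal_le_ofReal (by linarith)

theorem cfMeasure_le {α : ℝ} (hα : 1 / 2 ≤ α) (hα1 : α ≤ 1) :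
    cfMeasure α ≤ (4 : ℝ≥0∞) • volume.restrict (Ioo 0 α) := by
  rw [cfMeasure, ← withDensity_const]
  refine withDensity_mono ?_
  rw [Filter.EventuallyLE, ae_restrict_iff' measurableSet_Ioo]
  filter_upwards [ae_isDensityContinuityPoint hα] with y h hy
  rw [← ENNReal.ofReal_ofNat]
  exact ENNReal.ofReal_le_ofReal (cfDensity_le hα hα1 hy.1 hy.2 h)

theorem map_iterate_cfMap_le {α : ℝ} (hα : 1 / 2 ≤ α) (hα1 : α ≤ 1) (n : ℕ) :
    (cfMeasure α).map (cfMap α)^[n] ≤ cfMeasure α := by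
  induction n with
  | zero => simp
  | succ n ih =>
    have hm := measurable_cfMap α
    rw [Function.iterate_succ, ← Measure.map_map (hm.iterate n) hm]
    exact (Measure.map_mono (map_cfMap_le hα hα1) (hm.iterate n)).trans ih

/-! ### Null sets and uniform L^p bounds. -/

theorem quasiMeasurePreserving_cfFold {α : ℝ} (hα : 1 / 2 ≤ α) (hα1 : α ≤ 1) :
    Measure.QuasiMeasurePreserving (cfFold α) volume (volume.restrict (Ioo 0 α)) := by
  refine ⟨measurable_cfFold α, Measure.AbsolutelyContinuous.mk fun s hs h0 => ?_⟩
  have hG : Measurable (s.indicator (1 : ℝ → ℝ≥0∞)) := measurable_one.indicator hs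
  have h := lintegral_cfFold_le hα hα1 hG (H := fun _ => 1) measurable_const
  rw [← lintegral_indicator_one hs, lintegral_map hG (measurable_cfFold α)]
  simp only [mul_one] at h
  refine le_antisymm (h.trans (le_of_eq ?_)) zero_le
  refine (lintegral_congr_ae ?_).trans lintegral_zero
  filter_upwards [measure_eq_zero_iff_ae_notMem.1 h0] with y hy
  rw [indicator_of_notMem hy, zero_mul]

theorem quasiMeasurePreserving_cfMap {α : ℝ} (hα : 1 / 2 ≤ α) (hα1 : α ≤ 1) :
    Measure.QuasiMeasurePreserving (cfMap α) (volume.restrict (Ioo 0 α))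
      (volume.restrict (Ioo 0 α)) := by
  have h1 : volume.restrict (Ioo 0 α) ≪ cfMeasure α :=
    Measure.absolutelyContinuous_of_le_smul (volume_restrict_le_cfMeasure hα hα1)
  have h2 : cfMeasure α ≪ volume.restrict (Ioo 0 α) :=
    Measure.absolutelyContinuous_of_le_smul (cfMeasure_le hα hα1)
  exact ⟨measurable_cfMap α, (h1.map (measurable_cfMap α)).trans
    ((Measure.absolutelyContinuous_of_le (map_cfMap_le hα hα1)).trans h2)⟩

theorem ae_inv_of_ae {P : ℝ → Prop} (h : ∀ᵐ x : ℝ, P x) : ∀ᵐ x : ℝ, P x⁻¹ := by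
  have hs : volume ({x | ¬ P x} \ {0}) = 0 :=
    measure_mono_null sdiff_subset (ae_iff.1 h)
  have h1 := addHaar_image_eq_zero_of_differentiableOn_of_addHaar_eq_zero volume
    (f := fun x : ℝ => x⁻¹) (s := {x | ¬ P x} \ {0})
    (fun x hx => (differentiableAt_inv hx.2).differentiableWithinAt) hs
  filter_upwards [measure_eq_zero_iff_ae_notMem.1 h1, Measure.ae_ne volume (0 : ℝ)] with x hx hx0
  by_contra hP
  exact hx ⟨x⁻¹, ⟨hP, inv_ne_zero hx0⟩, inv_inv x⟩

/-- Lebesgue measure is exchanged for `cfMeasure α` and back only once, whatever n is, so the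
constant does not depend on n. -/
theorem eLpNorm_comp_iterate_cfMap_le {E : Type*} [NormedAddCommGroup E] {α : ℝ}
    (hα : 1 / 2 ≤ α) (hα1 : α ≤ 1) (p : ℝ≥0∞) {h : ℝ → E}
    (hh : AEStronglyMeasurable h (volume.restrict (Ioo 0 α))) (n : ℕ) :
    eLpNorm (h ∘ (cfMap α)^[n]) p (volume.restrict (Ioo 0 α)) ≤
      3 ^ (1 / p).toReal * (4 ^ (1 / p).toReal * eLpNorm h p (volume.restrict (Ioo 0 α))) := by
  have h2 : cfMeasure α ≪ volume.restrict (Ioo 0 α) :=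
    Measure.absolutelyContinuous_of_le_smul (cfMeasure_le hα hα1)
  have hle := map_iterate_cfMap_le hα hα1 n
  have hm : Measurable (cfMap α)^[n] := (measurable_cfMap α).iterate n
  refine (eLpNorm_le_of_measure_le_smul (volume_restrict_le_cfMeasure hα hα1)).trans ?_
  rw [smul_eq_mul]
  gcongr
  rw [← eLpNorm_map_measure ((hh.mono_ac h2).mono_measure hle) hm.aemeasurable]
  exact (eLpNorm_mono_measure h hle).trans
    (eLpNorm_le_of_measure_le_smul (cfMeasure_le hα hα1))

/-! ### The space as L^p(0, α). -/

section Space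

variable {𝕜 : Type*} [RCLike 𝕜]

theorem brjunoTerm_cfFold {α : ℝ} (hα : 1 / 2 ≤ α) (hα1 : α ≤ 1) (f : ℝ → 𝕜) (x : ℝ) :
    brjunoTerm α f (cfFold α x) = brjunoTerm α f x := by
  ext n
  simp only [brjunoTerm, cfBeta_cfFold hα hα1, cfSeq_cfFold hα hα1]

theorem mul_brjunoTerm_cfMap {α : ℝ} (hα : 1 / 2 ≤ α) (hα1 : α ≤ 1) (f : ℝ → 𝕜) (x : ℝ) (n : ℕ) :
    (cfFold α x : 𝕜) * brjunoTerm α f (cfMap α (cfFold α x)) n = brjunoTerm α f x (n + 1) := by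
  simp only [brjunoTerm, cfSeq_cfMap hα hα1, ← cfBeta_cfMap hα hα1]
  push_cast
  ring

theorem eLpNorm_brjunoTerm_le {α : ℝ} (hα : 1 / 2 ≤ α) (hα1 : α ≤ 1) (p : ℝ≥0∞) {f : ℝ → 𝕜}
    (hf : AEStronglyMeasurable f (volume.restrict (Ioo 0 α))) (n : ℕ) :
    eLpNorm (fun x => brjunoTerm α f x n) p (volume.restrict (Ioo 0 α)) ≤
      ENNReal.ofReal (4 * brjunoLambda α ^ n) *
      (3 ^ (1 / p).toReal * (4 ^ (1 / p).toReal * eLpNorm f p (volume.restrict (Ioo 0 α)))) := by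
  have h : ∀ᵐ x ∂(volume.restrict (Ioo 0 α)), ‖brjunoTerm α f x n‖ ≤
      4 * brjunoLambda α ^ n * ‖(f ∘ (cfMap α)^[n]) x‖ := by
    rw [ae_restrict_iff' measurableSet_Ioo]
    refine Eventually.of_forall fun x hx => ?_
    rw [brjunoTerm, norm_mul, cfSeq_eq_iterate, cfFold_of_mem hx.1.le hx.2 hα1,
      RCLike.norm_ofReal, abs_of_nonneg (cfBeta_nonneg α x n)]
    exact mul_le_mul_of_nonneg_right (cfBeta_le hα hα1 x n) (norm_nonneg _)
  refine (eLpNorm_le_mul_eLpNorm_of_ae_le_mul h p).trans ?_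
  gcongr
  exact eLpNorm_comp_iterate_cfMap_le hα hα1 p hf n

variable {α : Icc (1 / 2 : ℝ) 1} {p : ℝ≥0∞}

/-- Elements of the space agree almost everywhere with their pullback under the folding map. -/
theorem brjunoSpace_ae_eq_cfFold (f : brjunoSpace 𝕜 α p) :
    ∀ᵐ x : ℝ, (f : ℝ →ₘ[(volume : Measure ℝ)] 𝕜) (cfFold α x) =
      (f : ℝ →ₘ[(volume : Measure ℝ)] 𝕜) x := by
  obtain ⟨hf1, hf2, -⟩ := f.2
  obtain ⟨hα, hα1⟩ := α.2
  generalize (f : ℝ →ₘ[(volume : Measure ℝ)] 𝕜) = F at hf1 hf2 ⊢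
  rw [ae_restrict_iff' measurableSet_Ioo] at hf2
  have hper : ∀ᵐ x : ℝ, ∀ k : ℤ, F (x + k + 1) = F (x + k) :=
    ae_all_iff.2 fun k => (measurePreserving_add_right volume (k : ℝ)).quasiMeasurePreserving.ae hf1
  have hneg : ∀ᵐ x : ℝ, ∀ k : ℤ, k - x ∈ Ioo (0 : ℝ) (1 - α) → F (-(k - x)) = F (k - x) :=
    ae_all_iff.2 fun k => (volume.measurePreserving_sub_left (k : ℝ)).quasiMeasurePreserving.ae hf2
  filter_upwards [hper, hneg, exists_int_sub_mem_Ioo (α : ℝ)] with x h1 h2 ⟨k, hk⟩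
  have h3 : ∀ k : ℤ, F (x + k) = F x := by
    intro k
    induction k using Int.induction_on with
    | zero => simp
    | succ i ih =>
      have := h1 i
      push_cast at this ih ⊢
      rw [← add_assoc, this, ih]
    | pred i ih =>
      have := h1 (-i - 1)
      push_cast at this ih ⊢
      rw [← this, ← ih]
      congr 1
      ring
  have h4 : cfFold α x = cfFold α (x - k) := by
    rw [← cfFold_add_intCast α (x - k) k, sub_add_cancel]
  have h5 : F (x - k) = F x := by
    have := h3 (-k)
    push_cast at this
    rwa [← sub_eq_add_neg] at this
  rcases hk with hk | hk
  · rw [h4, cfFold_of_mem hk.1.le hk.2 hα1, h5]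
  · rw [h4, show x - k = -(k - x) by ring, cfFold_of_neg_mem hk.1.le hk.2 hα, ← h2 k hk,
      neg_sub, h5]

theorem brjunoSpace_ext {f g : brjunoSpace 𝕜 α p}
    (h : ∀ᵐ x ∂(volume.restrict (Ioo (0 : ℝ) α)), (f : ℝ →ₘ[(volume : Measure ℝ)] 𝕜) x =
      (g : ℝ →ₘ[(volume : Measure ℝ)] 𝕜) x) : f = g := by
  refine Subtype.ext (AEEqFun.ext ?_)
  filter_upwards [brjunoSpace_ae_eq_cfFold f, brjunoSpace_ae_eq_cfFold g,
    (quasiMeasurePreserving_cfFold α.2.1 α.2.2).ae h] with x h1 h2 h3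
  rw [← h1, ← h2, h3]

/-- The extension of a function on `(0, α)` to an element of the space. -/
noncomputable def brjunoExtend (h : ℝ → 𝕜) (hh : MemLp h p (volume.restrict (Ioo (0 : ℝ) α))) :
    brjunoSpace 𝕜 α p :=
  ⟨AEEqFun.mk (h ∘ cfFold α)
    (hh.1.comp_quasiMeasurePreserving (quasiMeasurePreserving_cfFold α.2.1 α.2.2)), by
    set F := AEEqFun.mk (h ∘ cfFold α) (μ := volume)
      (hh.1.comp_quasiMeasurePreserving (quasiMeasurePreserving_cfFold α.2.1 α.2.2)) with hF
    have h0 : ∀ᵐ x : ℝ, F x = h (cfFold α x) := AEEqFun.coeFn_mk _ _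
    have h1 := (measurePreserving_add_right (volume : Measure ℝ) 1).quasiMeasurePreserving.ae h0
    have h2 := (Measure.measurePreserving_neg (volume : Measure ℝ)).quasiMeasurePreserving.ae h0
    refine ⟨?_, ?_, ?_⟩
    · filter_upwards [h0, h1] with x a b
      have := cfFold_add_intCast (α : ℝ) x 1
      push_cast at this
      rw [a, b, this]
    · rw [ae_restrict_iff' measurableSet_Ioo]
      filter_upwards [h0, h2] with x a b hx
      rw [a, b, cfFold_of_neg_mem hx.1.le hx.2 α.2.1, cfFold_of_mem hx.1.le
        (by linarith [hx.2, α.2.1]) α.2.2]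
    · refine (memLp_congr_ae ?_).2 hh
      rw [Filter.EventuallyEq, ae_restrict_iff' measurableSet_Ioo]
      filter_upwards [h0] with x a hx
      rw [a, cfFold_of_mem hx.1.le hx.2 α.2.2]⟩

theorem coeFn_brjunoExtend (h : ℝ → 𝕜) (hh : MemLp h p (volume.restrict (Ioo (0 : ℝ) α))) :
    ∀ᵐ x : ℝ, (brjunoExtend h hh : ℝ →ₘ[(volume : Measure ℝ)] 𝕜) x = h (cfFold α x) :=
  AEEqFun.coeFn_mk _ _

theorem coeFn_brjunoExtend_restrict (h : ℝ → 𝕜)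
    (hh : MemLp h p (volume.restrict (Ioo (0 : ℝ) α))) :
    (brjunoExtend h hh : ℝ →ₘ[(volume : Measure ℝ)] 𝕜) =ᵐ[volume.restrict (Ioo (0 : ℝ) α)] h := by
  rw [Filter.EventuallyEq, ae_restrict_iff' measurableSet_Ioo]
  filter_upwards [coeFn_brjunoExtend h hh] with x a hx
  rw [a, cfFold_of_mem hx.1.le hx.2 α.2.2]

theorem memLp_brjunoSpace (f : brjunoSpace 𝕜 α p) :
    MemLp (f : ℝ →ₘ[(volume : Measure ℝ)] 𝕜) p (volume.restrict (Ioo (0 : ℝ) α)) := f.2.2.2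

theorem coeFn_brjunoSpace_add (f g : brjunoSpace 𝕜 α p) :
    ∀ᵐ x : ℝ, ((f + g : brjunoSpace 𝕜 α p) : ℝ →ₘ[(volume : Measure ℝ)] 𝕜) x =
      (f : ℝ →ₘ[(volume : Measure ℝ)] 𝕜) x + (g : ℝ →ₘ[(volume : Measure ℝ)] 𝕜) x :=
  AEEqFun.coeFn_add _ _

theorem coeFn_brjunoSpace_smul (c : 𝕜) (f : brjunoSpace 𝕜 α p) :
    ∀ᵐ x : ℝ, ((c • f : brjunoSpace 𝕜 α p) : ℝ →ₘ[(volume : Measure ℝ)] 𝕜) x =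
      c * (f : ℝ →ₘ[(volume : Measure ℝ)] 𝕜) x :=
  AEEqFun.coeFn_smul c (f : ℝ →ₘ[(volume : Measure ℝ)] 𝕜)

variable [Fact (1 ≤ p)]

/-- The restriction to `(0, α)` is an isometry onto `L^p(0, α)`. -/
noncomputable def brjunoRestrict :
    brjunoSpace 𝕜 α p →ₗᵢ[𝕜] Lp 𝕜 p (volume.restrict (Ioo (0 : ℝ) α)) where
  toFun f := (memLp_brjunoSpace f).toLp _
  map_add' f g := by
    rw [← MemLp.toLp_add, MemLp.toLp_eq_toLp_iff]
    exact ae_restrict_of_ae (coeFn_brjunoSpace_add f g)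
  map_smul' c f := by
    rw [RingHom.id_apply, ← MemLp.toLp_const_smul, MemLp.toLp_eq_toLp_iff]
    exact ae_restrict_of_ae (coeFn_brjunoSpace_smul c f)
  norm_map' f := Lp.norm_toLp _ (memLp_brjunoSpace f)

theorem brjunoRestrict_surjective :
    Function.Surjective (brjunoRestrict (𝕜 := 𝕜) (α := α) (p := p)) := by
  intro h
  refine ⟨brjunoExtend h (Lp.memLp h), ?_⟩
  exact ((MemLp.toLp_eq_toLp_iff (memLp_brjunoSpace (brjunoExtend h (Lp.memLp h)))
    (Lp.memLp h)).2 (coeFn_brjunoExtend_restrict _ _)).trans (Lp.toLp_coeFn h (Lp.memLp h))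

theorem completeSpace_brjunoSpace : CompleteSpace (brjunoSpace 𝕜 α p) :=
  (LinearIsometryEquiv.ofSurjective (brjunoRestrict (𝕜 := 𝕜) (α := α) (p := p))
    brjunoRestrict_surjective).toIsometryEquiv.completeSpace

end Space

/-! ### The Brjuno operator and its powers. -/

theorem quasiMeasurePreserving_cfSeq {α : ℝ} (hα : 1 / 2 ≤ α) (hα1 : α ≤ 1) (n : ℕ) :
    Measure.QuasiMeasurePreserving (fun x => cfSeq α x n) volume (volume.restrict (Ioo 0 α)) := by
  simp only [cfSeq_eq_iterate]
  exact ((quasiMeasurePreserving_cfMap hα hα1).iterate n).comp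
    (quasiMeasurePreserving_cfFold hα hα1)

theorem measurable_cfBeta {α : ℝ} (hα : 1 / 2 ≤ α) (hα1 : α ≤ 1) (n : ℕ) :
    Measurable fun x => cfBeta α x n :=
  Finset.measurable_fun_prod _ fun i _ => (quasiMeasurePreserving_cfSeq hα hα1 i).measurable

section Operator

variable {𝕜 : Type*} [RCLike 𝕜]

theorem brjunoTerm_one (α : ℝ) (f : ℝ → 𝕜) (x : ℝ) :
    brjunoTerm α f x 1 = (cfFold α x : 𝕜) * f (cfMap α (cfFold α x)) := by
  simp [brjunoTerm, cfBeta, cfSeq_zero, cfSeq_succ]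

theorem aestronglyMeasurable_brjunoTerm {α : ℝ} (hα : 1 / 2 ≤ α) (hα1 : α ≤ 1) {f : ℝ → 𝕜}
    (hf : AEStronglyMeasurable f (volume.restrict (Ioo 0 α))) (n : ℕ) :
    AEStronglyMeasurable (fun x => brjunoTerm α f x n) volume :=
  (RCLike.measurable_ofReal.comp (measurable_cfBeta hα hα1 n)).aestronglyMeasurable.mul
    (hf.comp_quasiMeasurePreserving (quasiMeasurePreserving_cfSeq hα hα1 n))

theorem memLp_brjunoTerm {α : ℝ} (hα : 1 / 2 ≤ α) (hα1 : α ≤ 1) {p : ℝ≥0∞} {f : ℝ → 𝕜}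
    (hf : MemLp f p (volume.restrict (Ioo 0 α))) (n : ℕ) :
    MemLp (fun x => brjunoTerm α f x n) p (volume.restrict (Ioo 0 α)) := by
  refine ⟨(aestronglyMeasurable_brjunoTerm hα hα1 hf.1 n).restrict,
    (eLpNorm_brjunoTerm_le hα hα1 p hf.1 n).trans_lt ?_⟩
  refine ENNReal.mul_lt_top ENNReal.ofReal_lt_top (ENNReal.mul_lt_top ?_
    (ENNReal.mul_lt_top ?_ hf.2))
  all_goals exact ENNReal.rpow_lt_top_of_nonneg ENNReal.toReal_nonneg (by norm_num)

theorem brjunoTerm_congr_ae {α : ℝ} (hα : 1 / 2 ≤ α) (hα1 : α ≤ 1) {f g : ℝ → 𝕜}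
    (h : ∀ᵐ x : ℝ, f x = g x) (n : ℕ) :
    ∀ᵐ x : ℝ, brjunoTerm α f x n = brjunoTerm α g x n := by
  filter_upwards [(quasiMeasurePreserving_cfSeq hα hα1 n).ae (ae_restrict_of_ae h)] with x hx
  rw [brjunoTerm, brjunoTerm, hx]

/-- The Brjuno series converges absolutely almost everywhere. -/
theorem ae_summable_brjunoTerm {α : ℝ} (hα : 1 / 2 ≤ α) (hα1 : α ≤ 1) {f : ℝ → 𝕜}
    (hf : MemLp f 1 (volume.restrict (Ioo 0 α))) :
    ∀ᵐ x : ℝ, Summable (brjunoTerm α f x) := by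
  have hm : ∀ n, AEMeasurable (fun x => ‖brjunoTerm α f x n‖ₑ) (volume.restrict (Ioo 0 α)) :=
    fun n => (memLp_brjunoTerm hα hα1 hf n).1.enorm
  have hl0 := brjunoLambda_pos α
  have hl1 := brjunoLambda_lt_one α
  have hsum : Summable fun n => 4 * brjunoLambda α ^ n :=
    (summable_geometric_of_lt_one hl0.le hl1).mul_left 4
  -- The L¹ norms of the terms are dominated by a geometric series of ratio λ(α) < 1.
  have hfin : ∫⁻ x in Ioo 0 α, ∑' n, ‖brjunoTerm α f x n‖ₑ ≠ ∞ := by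
    rw [lintegral_tsum hm]
    have hle : ∀ n, ∫⁻ x in Ioo 0 α, ‖brjunoTerm α f x n‖ₑ ≤
        ENNReal.ofReal (4 * brjunoLambda α ^ n) * (3 ^ (1 / (1 : ℝ≥0∞)).toReal *
          (4 ^ (1 / (1 : ℝ≥0∞)).toReal * eLpNorm f 1 (volume.restrict (Ioo 0 α)))) := by
      intro n
      rw [← eLpNorm_one_eq_lintegral_enorm]
      exact eLpNorm_brjunoTerm_le hα hα1 1 hf.1 n
    refine ne_top_of_le_ne_top ?_ (ENNReal.tsum_le_tsum hle)
    rw [ENNReal.tsum_mul_right, ← ENNReal.ofReal_tsum_of_nonneg (fun n => by positivity) hsum]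
    refine ENNReal.mul_ne_top ENNReal.ofReal_ne_top (ENNReal.mul_ne_top ?_
      (ENNReal.mul_ne_top ?_ hf.2.ne))
    all_goals exact ENNReal.rpow_ne_top_of_nonneg ENNReal.toReal_nonneg (by norm_num)
  have hae : ∀ᵐ x ∂(volume.restrict (Ioo 0 α)), Summable (brjunoTerm α f x) := by
    filter_upwards [ae_lt_top' (AEMeasurable.tsum hm) hfin] with x hx
    refine Summable.of_nnnorm ?_
    exact ENNReal.tsum_coe_ne_top_iff_summable.1 hx.ne
  filter_upwards [(quasiMeasurePreserving_cfFold hα hα1).ae hae] with x hx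
  rwa [brjunoTerm_cfFold hα hα1] at hx

variable {α : Icc (1 / 2 : ℝ) 1} {p : ℝ≥0∞}

theorem norm_le_of_ae_eq_brjunoTerm {f g : brjunoSpace 𝕜 α p} {n : ℕ}
    (h : ∀ᵐ x : ℝ, (g : ℝ →ₘ[(volume : Measure ℝ)] 𝕜) x =
      brjunoTerm (α : ℝ) (f : ℝ →ₘ[(volume : Measure ℝ)] 𝕜) x n) :
    ‖g‖ ≤ 4 * brjunoLambda α ^ n * ((3 ^ (1 / p).toReal * 4 ^ (1 / p).toReal) * ‖f‖) := by
  have hf := memLp_brjunoSpace f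
  have hl0 := brjunoLambda_pos α
  change (eLpNorm (g : ℝ →ₘ[(volume : Measure ℝ)] 𝕜) p
    (volume.restrict (Ioo (0 : ℝ) α))).toReal ≤ _ * (_ * (eLpNorm
      (f : ℝ →ₘ[(volume : Measure ℝ)] 𝕜) p (volume.restrict (Ioo (0 : ℝ) α))).toReal)
  rw [eLpNorm_congr_ae (ae_restrict_of_ae h)]
  have h1 := eLpNorm_brjunoTerm_le α.2.1 α.2.2 p hf.1 n
  refine (ENNReal.toReal_mono ?_ h1).trans (le_of_eq ?_)
  · refine ENNReal.mul_ne_top ENNReal.ofReal_ne_top (ENNReal.mul_ne_top ?_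
      (ENNReal.mul_ne_top ?_ hf.2.ne))
    all_goals exact ENNReal.rpow_ne_top_of_nonneg ENNReal.toReal_nonneg (by norm_num)
  · rw [ENNReal.toReal_mul, ENNReal.toReal_mul, ENNReal.toReal_mul, ← ENNReal.toReal_rpow,
      ← ENNReal.toReal_rpow, ENNReal.toReal_ofReal (by positivity), ENNReal.toReal_ofNat,
      ENNReal.toReal_ofNat, mul_assoc (3 ^ (1 / p).toReal : ℝ)]

theorem coeFn_brjunoExtend_brjunoTerm (f : brjunoSpace 𝕜 α p) (n : ℕ) : ∀ᵐ x : ℝ,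
    (brjunoExtend (fun x => brjunoTerm (α : ℝ) (f : ℝ →ₘ[(volume : Measure ℝ)] 𝕜) x n)
      (memLp_brjunoTerm α.2.1 α.2.2 (memLp_brjunoSpace f) n) : ℝ →ₘ[(volume : Measure ℝ)] 𝕜) x =
    brjunoTerm (α : ℝ) (f : ℝ →ₘ[(volume : Measure ℝ)] 𝕜) x n := by
  filter_upwards [coeFn_brjunoExtend _
    (memLp_brjunoTerm α.2.1 α.2.2 (memLp_brjunoSpace f) n)] with x hx
  rw [hx, brjunoTerm_cfFold α.2.1 α.2.2]

variable [Fact (1 ≤ p)]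

/-- The Brjuno operator `T f (x) = x f (1 / x)`. -/
noncomputable def brjunoOperator : brjunoSpace 𝕜 α p →L[𝕜] brjunoSpace 𝕜 α p :=
  LinearMap.mkContinuous
    { toFun := fun f =>
        brjunoExtend (fun x => brjunoTerm (α : ℝ) (f : ℝ →ₘ[(volume : Measure ℝ)] 𝕜) x 1)
          (memLp_brjunoTerm α.2.1 α.2.2 (memLp_brjunoSpace f) 1)
      map_add' := fun f g => by
        refine brjunoSpace_ext (ae_restrict_of_ae ?_)
        filter_upwards [coeFn_brjunoExtend_brjunoTerm f 1, coeFn_brjunoExtend_brjunoTerm g 1,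
          coeFn_brjunoExtend_brjunoTerm (f + g) 1, coeFn_brjunoSpace_add (𝕜 := 𝕜) (brjunoExtend _ _) (brjunoExtend _ _),
          brjunoTerm_congr_ae α.2.1 α.2.2 (coeFn_brjunoSpace_add f g) 1] with x h1 h2 h3 h4 h5
        rw [h4, h1, h2, h3, h5]
        simp only [brjunoTerm]
        ring
      map_smul' := fun c f => by
        refine brjunoSpace_ext (ae_restrict_of_ae ?_)
        filter_upwards [coeFn_brjunoExtend_brjunoTerm f 1,
          coeFn_brjunoExtend_brjunoTerm (c • f) 1, coeFn_brjunoSpace_smul c _,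
          brjunoTerm_congr_ae α.2.1 α.2.2 (coeFn_brjunoSpace_smul c f) 1] with x h1 h3 h4 h5
        rw [RingHom.id_apply, h4, h1, h3, h5]
        simp only [brjunoTerm]
        ring }
    (4 * brjunoLambda α ^ 1 * (3 ^ (1 / p).toReal * 4 ^ (1 / p).toReal))
    fun f : brjunoSpace 𝕜 α p =>
      (norm_le_of_ae_eq_brjunoTerm (coeFn_brjunoExtend_brjunoTerm f 1)).trans_eq (mul_assoc _ _ _).symm

theorem coeFn_brjunoOperator (f : brjunoSpace 𝕜 α p) : ∀ᵐ x : ℝ,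
    (brjunoOperator f : ℝ →ₘ[(volume : Measure ℝ)] 𝕜) x =
      brjunoTerm (α : ℝ) (f : ℝ →ₘ[(volume : Measure ℝ)] 𝕜) x 1 :=
  coeFn_brjunoExtend_brjunoTerm f 1

theorem coeFn_brjunoOperator_pow (f : brjunoSpace 𝕜 α p) (n : ℕ) : ∀ᵐ x : ℝ,
    ((brjunoOperator ^ n) f : ℝ →ₘ[(volume : Measure ℝ)] 𝕜) x =
      brjunoTerm (α : ℝ) (f : ℝ →ₘ[(volume : Measure ℝ)] 𝕜) x n := by
  induction n with
  | zero =>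
    filter_upwards [brjunoSpace_ae_eq_cfFold f] with x hx
    simp [brjunoTerm, cfBeta, cfSeq_zero, hx]
  | succ n ih =>
    filter_upwards [coeFn_brjunoOperator ((brjunoOperator ^ n) f),
      brjunoTerm_congr_ae α.2.1 α.2.2 ih 1] with x h1 h2
    rw [pow_succ', mul_apply_eq_comp, h1, h2, brjunoTerm_one,
      mul_brjunoTerm_cfMap α.2.1 α.2.2]

theorem isBrjunoImage_brjunoOperator (f : brjunoSpace 𝕜 α p) :
    IsBrjunoImage f (brjunoOperator f) := by
  rw [IsBrjunoImage, ae_restrict_iff' measurableSet_Ioo]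
  filter_upwards [coeFn_brjunoOperator f, ae_inv_of_ae (brjunoSpace_ae_eq_cfFold f)] with x h1 h2 hx
  rw [h1, brjunoTerm_one, cfFold_of_mem hx.1.le hx.2 α.2.2, cfMap, h2, inv_eq_one_div]

theorem brjunoOperator_eq_iff (f g : brjunoSpace 𝕜 α p) :
    brjunoOperator f = g ↔ IsBrjunoImage f g := by
  refine ⟨fun h => h ▸ isBrjunoImage_brjunoOperator f, fun h => brjunoSpace_ext ?_⟩
  filter_upwards [isBrjunoImage_brjunoOperator f, h] with x h1 h2
  rw [h1, h2]

theorem norm_brjunoOperator_pow_le (n : ℕ) :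
    ‖(brjunoOperator : brjunoSpace 𝕜 α p →L[𝕜] brjunoSpace 𝕜 α p) ^ n‖ ≤
      4 * (3 ^ (1 / p).toReal * 4 ^ (1 / p).toReal) * brjunoLambda α ^ n := by
  have hl0 := brjunoLambda_pos α
  refine ContinuousLinearMap.opNorm_le_bound _ (by positivity) fun f => ?_
  exact (norm_le_of_ae_eq_brjunoTerm (coeFn_brjunoOperator_pow f n)).trans_eq (by ring)

theorem ae_brjunoTerm_eq_add {f B : brjunoSpace 𝕜 α p} (h : B = f + brjunoOperator B) (n : ℕ) :
    ∀ᵐ x : ℝ, brjunoTerm (α : ℝ) (B : ℝ →ₘ[(volume : Measure ℝ)] 𝕜) x n =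
      brjunoTerm (α : ℝ) (f : ℝ →ₘ[(volume : Measure ℝ)] 𝕜) x n +
        brjunoTerm (α : ℝ) (B : ℝ →ₘ[(volume : Measure ℝ)] 𝕜) x (n + 1) := by
  -- Applying T^n before evaluating gives the relation along almost every orbit.
  have e : (brjunoOperator ^ n) B = (brjunoOperator ^ n) f + (brjunoOperator ^ (n + 1)) B := by
    rw [pow_succ, mul_apply_eq_comp, ← map_add]
    exact congrArg _ h
  have h4 := coeFn_brjunoSpace_add ((brjunoOperator ^ n) f) ((brjunoOperator ^ (n + 1)) B)
  rw [← e] at h4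
  filter_upwards [coeFn_brjunoOperator_pow B n, coeFn_brjunoOperator_pow f n,
    coeFn_brjunoOperator_pow B (n + 1), h4] with x h1 h2 h3 h4
  rw [← h1, ← h2, ← h3, h4]

theorem ae_summable_brjunoTerm_brjunoSpace (f : brjunoSpace 𝕜 α p) :
    ∀ᵐ x : ℝ, Summable (brjunoTerm (α : ℝ) (f : ℝ →ₘ[(volume : Measure ℝ)] 𝕜) x) :=
  ae_summable_brjunoTerm α.2.1 α.2.2 ((memLp_brjunoSpace f).mono_exponent Fact.out)

/-- A solution `B` of `(1 - T) B = f` is the sum of the Brjuno series of `f`. -/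
theorem ae_eq_tsum_brjunoTerm {f B : brjunoSpace 𝕜 α p} (h : B = f + brjunoOperator B) :
    ∀ᵐ x : ℝ, (B : ℝ →ₘ[(volume : Measure ℝ)] 𝕜) x =
      ∑' n, brjunoTerm (α : ℝ) (f : ℝ →ₘ[(volume : Measure ℝ)] 𝕜) x n := by
  filter_upwards [ae_all_iff.2 (ae_brjunoTerm_eq_add h), coeFn_brjunoOperator_pow B 0,
    ae_summable_brjunoTerm_brjunoSpace f, ae_summable_brjunoTerm_brjunoSpace B] with x h1 h2 h3 h4
  rw [pow_zero, one_apply_eq_self] at h2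
  generalize brjunoTerm (α : ℝ) (B : ℝ →ₘ[(volume : Measure ℝ)] 𝕜) x = b at *
  generalize brjunoTerm (α : ℝ) (f : ℝ →ₘ[(volume : Measure ℝ)] 𝕜) x = a at *
  have hsum : ∀ n, b 0 - b n = ∑ i ∈ Finset.range n, a i := by
    intro n
    induction n with
    | zero => simp
    | succ n ih =>
      rw [Finset.sum_range_succ, ← ih, h1 n]
      ring
  -- The remainder T^n B(x) tends to 0 because the Brjuno series of B itself converges at x.
  have hlim := h4.tendsto_atTop_zero.const_sub (b 0)
  rw [sub_zero] at hlim
  rw [h2]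
  exact tendsto_nhds_unique hlim (h3.hasSum.tendsto_sum_nat.congr fun n => (hsum n).symm)

end Operator

/-! ### Gelfand's limit and the spectrum. -/

theorem exists_tendsto_norm_pow_one_div {𝕜 A : Type*} [NormedField 𝕜] [NormedRing A]
    [NormedAlgebra 𝕜 A] (h1 : ‖(1 : A)‖ ≤ 1) (a : A) :
    ∃ r : ℝ, Tendsto (fun n : ℕ => ‖a ^ n‖ ^ (1 / (n : ℝ))) atTop (𝓝 r) := by
  -- Pulling the norm back along q ↦ q(a) moves the question to a commutative ring, where the
  -- smoothing of a seminorm provides the limit.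
  let μ : RingSeminorm (Polynomial 𝕜) :=
    { toFun := fun q => ‖Polynomial.aeval a q‖
      map_zero' := by simp
      add_le' := fun q r => by simpa using norm_add_le _ _
      neg' := fun q => by simp
      mul_le' := fun q r => by simpa using norm_mul_le _ _ }
  have h := tendsto_smoothingFun_of_map_one_le_one μ
    (show ‖Polynomial.aeval a (1 : Polynomial 𝕜)‖ ≤ 1 by simpa using h1) Polynomial.X
  refine ⟨_, h.congr fun n => ?_⟩
  change ‖Polynomial.aeval a (Polynomial.X ^ n : Polynomial 𝕜)‖ ^ (1 / (n : ℝ)) = _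
  simp

theorem le_of_tendsto_norm_pow_one_div {A : Type*} [NormedRing A] {a : A} {C l r : ℝ}
    (hC : 0 < C) (hl : 0 ≤ l) (h : ∀ n, ‖a ^ n‖ ≤ C * l ^ n)
    (hr : Tendsto (fun n : ℕ => ‖a ^ n‖ ^ (1 / (n : ℝ))) atTop (𝓝 r)) : r ≤ l := by
  have h1 : Tendsto (fun n : ℕ => C ^ (1 / (n : ℝ)) * l) atTop (𝓝 (C ^ (0 : ℝ) * l)) :=
    (tendsto_const_nhds.rpow tendsto_one_div_atTop_nhds_zero_nat (Or.inl hC.ne')).mul_const l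
  rw [Real.rpow_zero, one_mul] at h1
  refine le_of_tendsto_of_tendsto hr h1 ?_
  filter_upwards [eventually_ne_atTop 0] with n hn
  refine (Real.rpow_le_rpow (norm_nonneg _) (h n) (by positivity)).trans_eq ?_
  rw [Real.mul_rpow hC.le (by positivity), one_div, Real.pow_rpow_inv_natCast hl hn]

/-- Only this half of Gelfand's formula is needed; unlike equality, it holds over the real field
too. -/
theorem spectralRadius_le_of_tendsto (𝕜 : Type*) {A : Type*} [NormedField 𝕜] [NormedRing A]
    [NormedAlgebra 𝕜 A] [CompleteSpace A] {a : A} {r : ℝ}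
    (hr : Tendsto (fun n : ℕ => ‖a ^ n‖ ^ (1 / (n : ℝ))) atTop (𝓝 r)) :
    spectralRadius 𝕜 a ≤ ENNReal.ofReal r := by
  refine (spectrum.spectralRadius_le_liminf_pow_nnnorm_pow_one_div 𝕜 a).trans (le_of_eq ?_)
  refine Tendsto.liminf_eq ((ENNReal.tendsto_ofReal hr).congr fun n => ?_)
  rw [← ENNReal.ofReal_rpow_of_nonneg (norm_nonneg _) (by positivity), ofReal_norm]
  rfl

theorem mainTheorem1 (𝕜 : Type*) [RCLike 𝕜] (α : Set.Icc (1 / 2 : ℝ) 1) (p : ℝ≥0∞)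
    [Fact (1 ≤ p)] :
    -- the space is a Banach space
    CompleteSpace (brjunoSpace 𝕜 α p) ∧
    -- the Brjuno operator is a well defined bounded linear operator of the space into itself
    ∃ T : brjunoSpace 𝕜 α p →L[𝕜] brjunoSpace 𝕜 α p,
      (∀ f g : brjunoSpace 𝕜 α p, T f = g ↔ IsBrjunoImage f g) ∧
      -- its spectral radius (by the spectrum, and by Gelfand's formula) is at most `λ(α)`
      spectralRadius 𝕜 T ≤ ENNReal.ofReal (brjunoLambda α) ∧
      (∃ r : ℝ, r ≤ brjunoLambda α ∧
        Tendsto (fun n : ℕ => ‖T ^ n‖ ^ (1 / (n : ℝ))) atTop (𝓝 r)) ∧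
      -- `1 - T` has a bounded inverse
      IsUnit (1 - T) ∧
      -- the Brjuno series converges almost everywhere, and its sum is the unique solution
      ∀ f : brjunoSpace 𝕜 α p,
        (∀ᵐ x : ℝ, Summable (brjunoTerm (α : ℝ) (f : ℝ →ₘ[(volume : Measure ℝ)] 𝕜) x)) ∧
        ∃ B : brjunoSpace 𝕜 α p,
          (∀ᵐ x : ℝ, (B : ℝ →ₘ[(volume : Measure ℝ)] 𝕜) x =
            ∑' n, brjunoTerm (α : ℝ) (f : ℝ →ₘ[(volume : Measure ℝ)] 𝕜) x n) ∧
          ∀ g : brjunoSpace 𝕜 α p, (1 - T) g = f ↔ g = B := by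
  have hcomplete : CompleteSpace (brjunoSpace 𝕜 α p) := completeSpace_brjunoSpace
  have hl0 := brjunoLambda_pos α
  have hl1 := brjunoLambda_lt_one α
  obtain ⟨r, hr⟩ := exists_tendsto_norm_pow_one_div (𝕜 := 𝕜) ContinuousLinearMap.norm_id_le
    (brjunoOperator : brjunoSpace 𝕜 α p →L[𝕜] brjunoSpace 𝕜 α p)
  have hrl := le_of_tendsto_norm_pow_one_div (by positivity) hl0.le norm_brjunoOperator_pow_le hr
  have hspec := (spectralRadius_le_of_tendsto 𝕜 hr).trans (ENNReal.ofReal_le_ofReal hrl)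
  have hunit : IsUnit (1 - (brjunoOperator : brjunoSpace 𝕜 α p →L[𝕜] brjunoSpace 𝕜 α p)) := by
    have := spectrum.mem_resolventSet_of_spectralRadius_lt (k := (1 : 𝕜))
      (hspec.trans_lt (by simpa using hl1))
    simpa [spectrum.mem_resolventSet_iff] using this
  refine ⟨hcomplete, brjunoOperator, brjunoOperator_eq_iff, hspec, ⟨r, hrl, hr⟩, hunit,
    fun f => ⟨ae_summable_brjunoTerm_brjunoSpace f, ?_⟩⟩
  obtain ⟨S, hS1, hS2⟩ := isUnit_iff_exists.1 hunit
  have hB : S f - brjunoOperator (S f) = f := DFunLike.congr_fun hS1 f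
  refine ⟨S f, ae_eq_tsum_brjunoTerm (sub_eq_iff_eq_add.1 hB), fun g => ⟨?_, ?_⟩⟩
  · rintro rfl
    exact (DFunLike.congr_fun hS2 g).symm
  · rintro rfl
    exact DFunLike.congr_fun hS1 f
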